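/- Let $p,q\ge 3$, let $I_{p,q}=\begin{pmatrix}-I_p&0\\0&I_q\end{pmatrix}$, and let $G=\mathrm{SO}^\circ(p,q)$ be the identity component of the Lie group $\{X\in \mathrm{SL}_{p+q}(\mathbb{R}) : X I_{p,q}X^{T}=I_{p,q}\}$. Let $K=\mathrm{SO}(p)\times\mathrm{SO}(q)\le G$ be the subgroup of the block-diagonal matrices $\begin{pmatrix}A&0\\0&B\end{pmatrix}\in G$ with $A\in\mathrm{SO}(p)$, $B\in\mathrm{SO}(q)$. Suppose that $G$ acts real-analytically (that is, the action map $G\times M\to M$ is real-analytic) and non-trivially on a connected Hausdorff real-analytic manifold $M$ without boundary, of dimension $p+q-1$ (not necessarily compact). Then $K$ has no fixed point in $M$. In particular, $G$ has no fixed point in $M$. -/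

import Mathlib

open scoped Manifold ContDiff Topology

noncomputable section

namespace SOAction

/-- The matrix `I_{p,q} = diag(-I_p, I_q)`. -/
def Ipq (p q : ℕ) : Matrix (Fin p ⊕ Fin q) (Fin p ⊕ Fin q) ℝ :=
  Matrix.fromBlocks (-1) 0 0 1

/-- `SO(p,q) = {X ∈ SL_{p+q}(ℝ) : X I_{p,q} Xᵀ = I_{p,q}}`, as a subgroup of `SL_{p+q}(ℝ)`. -/
def SOpq (p q : ℕ) : Subgroup (Matrix.SpecialLinearGroup (Fin p ⊕ Fin q) ℝ) where
  carrier := {X | (X : Matrix (Fin p ⊕ Fin q) (Fin p ⊕ Fin q) ℝ) * Ipq p q *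
    (X : Matrix (Fin p ⊕ Fin q) (Fin p ⊕ Fin q) ℝ).transpose = Ipq p q}
  one_mem' := by simp
  mul_mem' := by
    intro X Y hX hY
    simp only [Set.mem_ofPred_eq, Matrix.SpecialLinearGroup.coe_mul, Matrix.transpose_mul] at *
    calc _ = (X : Matrix (Fin p ⊕ Fin q) (Fin p ⊕ Fin q) ℝ) * (Y.1 * Ipq p q * Y.1.transpose) *
          X.1.transpose := by simp only [Matrix.mul_assoc]
      _ = _ := by rw [hY, hX]
  inv_mem' := by
    intro X hX
    simp only [Set.mem_ofPred_eq] at *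
    have h1 : (X⁻¹).1 * X.1 = 1 := by
      rw [← Matrix.SpecialLinearGroup.coe_mul, inv_mul_cancel, Matrix.SpecialLinearGroup.coe_one]
    have h2 : X.1.transpose * (X⁻¹).1.transpose = 1 := by
      rw [← Matrix.transpose_mul, h1, Matrix.transpose_one]
    calc (X⁻¹).1 * Ipq p q * (X⁻¹).1.transpose
        = (X⁻¹).1 * (X.1 * Ipq p q * X.1.transpose) * (X⁻¹).1.transpose := by rw [hX]
      _ = ((X⁻¹).1 * X.1) * Ipq p q * (X.1.transpose * (X⁻¹).1.transpose) := by
          simp only [Matrix.mul_assoc]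
      _ = Ipq p q := by rw [h1, h2, Matrix.one_mul, Matrix.mul_one]

/-- `G = SO°(p,q)`, the identity component of `SO(p,q)` (for the topology of matrices), regarded
as a subgroup of `SL_{p+q}(ℝ)`. -/
def G (p q : ℕ) : Subgroup (Matrix.SpecialLinearGroup (Fin p ⊕ Fin q) ℝ) :=
  (Subgroup.connectedComponentOfOne (SOpq p q)).map (SOpq p q).subtype

/-- The matrix underlying an element of `SO°(p,q)`. -/
def mat {p q : ℕ} (g : G p q) : Matrix (Fin p ⊕ Fin q) (Fin p ⊕ Fin q) ℝ :=
  (g : Matrix.SpecialLinearGroup (Fin p ⊕ Fin q) ℝ).1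

/-- The array of matrix entries of an element of `SO°(p,q)`. -/
def entries {p q : ℕ} (g : G p q) : Fin p ⊕ Fin q → Fin p ⊕ Fin q → ℝ :=
  fun i j => mat g i j

theorem mat_one {p q : ℕ} : mat (1 : G p q) = 1 := rfl

theorem mat_mul {p q : ℕ} (g h : G p q) : mat (g * h) = mat g * mat h := rfl

theorem mem_so_transpose {n : ℕ} {A : Matrix (Fin n) (Fin n) ℝ}
    (hA : A ∈ Matrix.specialOrthogonalGroup (Fin n) ℝ) :
    A.transpose ∈ Matrix.specialOrthogonalGroup (Fin n) ℝ ∧ A * A.transpose = 1 := by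
  rw [Matrix.mem_specialOrthogonalGroup_iff, Matrix.mem_orthogonalGroup_iff] at *
  refine ⟨⟨?_, by rw [Matrix.det_transpose]; exact hA.2⟩, hA.1⟩
  have h := mul_eq_one_comm.1 hA.1
  simpa [Matrix.star_eq_conjTranspose] using h

/-- `K = SO(p) × SO(q)`: the elements of `SO°(p,q)` of the form `diag(A, B)` with `A ∈ SO(p)` and
`B ∈ SO(q)`. -/
def K (p q : ℕ) : Subgroup (G p q) where
  carrier := {g | ∃ A ∈ Matrix.specialOrthogonalGroup (Fin p) ℝ,
    ∃ B ∈ Matrix.specialOrthogonalGroup (Fin q) ℝ, mat g = Matrix.fromBlocks A 0 0 B}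
  one_mem' := ⟨1, one_mem _, 1, one_mem _, by rw [mat_one, Matrix.fromBlocks_one]⟩
  mul_mem' := by
    rintro g h ⟨A, hA, B, hB, hg⟩ ⟨A', hA', B', hB', hh⟩
    refine ⟨A * A', mul_mem hA hA', B * B', mul_mem hB hB', ?_⟩
    rw [mat_mul, hg, hh, Matrix.fromBlocks_multiply]
    simp
  inv_mem' := by
    rintro g ⟨A, hA, B, hB, hg⟩
    refine ⟨A.transpose, (mem_so_transpose hA).1, B.transpose, (mem_so_transpose hB).1, ?_⟩
    have h1 : mat g⁻¹ * mat g = 1 := by rw [← mat_mul, inv_mul_cancel, mat_one]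
    have h2 : mat g * Matrix.fromBlocks A.transpose 0 0 B.transpose = 1 := by
      rw [hg, Matrix.fromBlocks_multiply]
      simp [(mem_so_transpose hA).2, (mem_so_transpose hB).2]
    exact left_inv_eq_right_inv h1 h2

/-- An action of `SO°(p,q)` on a real-analytic `n`-manifold `M` is analytic if the action map
`SO°(p,q) × M → M` is real-analytic. The Lie group `SO°(p,q)` carries its standard structure of an
embedded analytic submanifold of the space of matrices, and so a map on `SO°(p,q) × M` is analytic
iff near each point it is the restriction of an analytic map that is defined near that point in
(matrices) `× M`. The space of matrices is written out here as the finite-dimensional real vector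
space of arrays of entries, where Mathlib has the analytic structure. -/
def IsAnalyticAction (p q n : ℕ) (M : Type*) [TopologicalSpace M]
    [ChartedSpace (EuclideanSpace ℝ (Fin n)) M] [MulAction (G p q) M] : Prop :=
  ∀ (g₀ : G p q) (x₀ : M),
    ∃ F : (Fin p ⊕ Fin q → Fin p ⊕ Fin q → ℝ) × M → M,
      ContMDiffAt (𝓘(ℝ, Fin p ⊕ Fin q → Fin p ⊕ Fin q → ℝ).prod (𝓡 n)) (𝓡 n) ω F
        (entries g₀, x₀) ∧
      ∀ᶠ z : G p q × M in 𝓝 (g₀, x₀), F (entries z.1, z.2) = z.1 • z.2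

end SOAction

end

/-!
Write `n = p + q - 1`, let `x₀` be a point fixed by `K`, and let `X i j` (`planeGen i j`) be the
generator of the one-parameter group of rotations or boosts in the plane of the coordinates `i`
and `j`. The proof shows that `SO°(p,q)` fixes `x₀`, and that a fixed point of `SO°(p,q)` makes the
action trivial.

*From `K` to `SO°(p,q)`.* The derivative of the orbit map of `x₀` is a linear map
`D : 𝔰𝔬(p,q) → T_{x₀} M` that is equivariant under `K` and vanishes on the Lie algebra of `K`. The
vectors `D (X i j)` of the `pq` boosts are joint eigenvectors of the half turns in `K`, with
distinct characters. Since `n < pq`, one of them vanishes, and since the kernel of `D` is invariant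
under brackets with rotations, all of them vanish. So every one-parameter group of a generator
fixes `x₀` (`fixed_of_K_fixed`).

*The isotropy representation is trivial.* More generally, a representation `ρ` of `SO°(p,q)` of
dimension less than `p + q` is trivial (`eq_one_of_finrank_lt`), whether continuous or not. Half
turns inside the blocks are commuting involutions, and the signs of their eigenvalues on a joint
eigenvector are encoded by a function `e` on the coordinates, up to a change of sign on each block.
Quarter turns permute the coordinates, so the functions `e` that occur form a set that is invariant
under permutations inside the blocks. Counting orbits gives at least `p + q` characters, unless some
diagonal element other than `±1` lies in the kernel, and the normal closure of such an element is
everything (`eq_top_of_diagonal_mem`). For a block of size `4` the signs `(+,+,-,-)` have only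
three images modulo sign. There one starts from an eigenvector on which `-1` of the block acts by
`-1`, which rules such signs out. This matters because the Lie algebra `𝔰𝔬(3,3) ≅ 𝔰𝔩(4,ℝ)` does
have a representation of dimension `4 < 6`: the argument has to see the group.

*Higher jets.* Once the isotropy representation is trivial, the leading term of the Taylor series
of `g - id` at `x₀` is additive in `g`. As `SO°(p,q)` is perfect, it vanishes, so `g` is the
identity near `x₀` (`eventually_eq_self_of_fderiv_eq_id`) and, by analytic continuation, everywhere
(`eq_self_of_eventually_eq_self`).

In place of general Lie theory the proof uses that a subgroup which contains the one-parameter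
groups of a spanning set of `𝔰𝔬(p,q)` is everything (`eq_top_of_span`).
-/

noncomputable section

namespace SOAction

/-! ### The Lie algebra and the exponential map -/

section LieAlgebra

open NormedSpace Matrix

variable {p q : ℕ}

/-- The diagonal of `I_{p,q}`: `-1` on the first block of indices and `1` on the second. -/
def sgn (p q : ℕ) : Fin p ⊕ Fin q → ℝ := Sum.elim (fun _ => -1) (fun _ => 1)

theorem Ipq_eq_diagonal : Ipq p q = diagonal (sgn p q) := by
  ext i j
  rcases i with i | i <;> rcases j with j | j <;> simp [Ipq, sgn, diagonal_apply, Matrix.one_apply]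
  split_ifs <;> simp

theorem sgn_mul_self (i : Fin p ⊕ Fin q) : sgn p q i * sgn p q i = 1 := by
  rcases i with i | i <;> simp [sgn]

theorem Ipq_mul_self : Ipq p q * Ipq p q = 1 := by
  rw [Ipq_eq_diagonal, diagonal_mul_diagonal, ← diagonal_one]
  congr 1; funext i; exact sgn_mul_self i

theorem Ipq_transpose : (Ipq p q)ᵀ = Ipq p q := by
  rw [Ipq_eq_diagonal, diagonal_transpose]

theorem isUnit_Ipq : IsUnit (Ipq p q) := ⟨⟨_, _, Ipq_mul_self, Ipq_mul_self⟩, rfl⟩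

/-- The Lie algebra `𝔰𝔬(p,q)`: the matrices `X` with `X I_{p,q} + I_{p,q} Xᵀ = 0`. -/
def so (p q : ℕ) : Submodule ℝ (Matrix (Fin p ⊕ Fin q) (Fin p ⊕ Fin q) ℝ) where
  carrier := {X | X * Ipq p q + Ipq p q * Xᵀ = 0}
  zero_mem' := by simp
  add_mem' := by
    intro X Y hX hY
    simp only [Set.mem_ofPred_eq, transpose_add, Matrix.add_mul, Matrix.mul_add] at *
    rw [add_add_add_comm, hX, hY, add_zero]
  smul_mem' := by
    intro c X hX
    simp only [Set.mem_ofPred_eq, transpose_smul, Matrix.smul_mul, Matrix.mul_smul] at *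
    rw [← smul_add, hX, smul_zero]

theorem mem_so {X : Matrix (Fin p ⊕ Fin q) (Fin p ⊕ Fin q) ℝ} :
    X ∈ so p q ↔ X * Ipq p q + Ipq p q * Xᵀ = 0 := Iff.rfl

theorem mem_so_iff_conj {X : Matrix (Fin p ⊕ Fin q) (Fin p ⊕ Fin q) ℝ} :
    X ∈ so p q ↔ Ipq p q * Xᵀ * Ipq p q = -X := by
  rw [mem_so]
  constructor
  · intro h
    rw [eq_neg_of_add_eq_zero_right h, Matrix.neg_mul, Matrix.mul_assoc, Ipq_mul_self,
      Matrix.mul_one]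
  · intro h
    have := congrArg (· * Ipq p q) h
    simp only [Matrix.mul_assoc, Ipq_mul_self, Matrix.mul_one, Matrix.neg_mul] at this
    rw [this, add_neg_cancel]

theorem orthogonal_iff {g : Matrix (Fin p ⊕ Fin q) (Fin p ⊕ Fin q) ℝ} :
    g * Ipq p q * gᵀ = Ipq p q ↔ g * (Ipq p q * gᵀ * Ipq p q) = 1 := by
  constructor
  · intro h
    rw [← Matrix.mul_assoc, ← Matrix.mul_assoc, h, Ipq_mul_self]
  · intro h
    have := congrArg (· * Ipq p q) h
    simpa only [Matrix.mul_assoc, Ipq_mul_self, Matrix.mul_one, Matrix.one_mul] using this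

theorem exp_orthogonal {X : Matrix (Fin p ⊕ Fin q) (Fin p ⊕ Fin q) ℝ} (hX : X ∈ so p q) :
    exp X * Ipq p q * (exp X)ᵀ = Ipq p q := by
  have hinv : (Ipq p q)⁻¹ = Ipq p q := Matrix.inv_eq_left_inv Ipq_mul_self
  have h := Matrix.exp_conj (Ipq p q) Xᵀ isUnit_Ipq
  rw [hinv, mem_so_iff_conj.1 hX, Matrix.exp_transpose] at h
  rw [orthogonal_iff, ← h, ← Matrix.exp_add_of_commute X (-X) (Commute.refl X).neg_right,
    add_neg_cancel, NormedSpace.exp_zero]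

theorem det_sq_of_orthogonal {g : Matrix (Fin p ⊕ Fin q) (Fin p ⊕ Fin q) ℝ}
    (hg : g * Ipq p q * gᵀ = Ipq p q) : g.det * g.det = 1 := by
  have h := congrArg Matrix.det (orthogonal_iff.1 hg)
  have h2 := congrArg Matrix.det (Ipq_mul_self (p := p) (q := q))
  simp only [Matrix.det_mul, Matrix.det_transpose, Matrix.det_one] at h h2
  linear_combination h - g.det * g.det * h2

theorem det_exp_of_mem_so {X : Matrix (Fin p ⊕ Fin q) (Fin p ⊕ Fin q) ℝ} (hX : X ∈ so p q) :
    (exp X).det = 1 := by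
  have h : exp X = exp ((2⁻¹ : ℝ) • X) * exp ((2⁻¹ : ℝ) • X) := by
    rw [← Matrix.exp_add_of_commute _ _ rfl, ← add_smul]; norm_num
  rw [h, Matrix.det_mul]
  exact det_sq_of_orthogonal (exp_orthogonal ((so p q).smul_mem _ hX))

/-- The exponential of `𝔰𝔬(p,q)` with values in `SO(p,q)`. -/
def expSO (X : so p q) : SOpq p q := ⟨⟨exp X.1, det_exp_of_mem_so X.2⟩, exp_orthogonal X.2⟩

section OperatorNorm
open scoped Matrix.Norms.Operator

theorem continuous_exp_matrix :
    Continuous (exp : Matrix (Fin p ⊕ Fin q) (Fin p ⊕ Fin q) ℝ → _) :=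
  NormedSpace.exp_continuous

end OperatorNorm

theorem continuous_expSO : Continuous (expSO : so p q → SOpq p q) :=
  Continuous.subtype_mk
    (Continuous.subtype_mk (continuous_exp_matrix.comp continuous_subtype_val) _) _

theorem expSO_zero : expSO (0 : so p q) = 1 := by
  apply Subtype.ext; apply Subtype.ext
  exact NormedSpace.exp_zero

theorem expSO_mem (X : so p q) : expSO X ∈ Subgroup.connectedComponentOfOne (SOpq p q) := by
  have hc : Continuous fun t : ℝ => expSO (t • X) := continuous_expSO.comp (by fun_prop)
  have h := (isPreconnected_univ.image _ hc.continuousOn).subset_connectedComponent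
    (x := (1 : SOpq p q)) ⟨0, trivial, by simp [expSO_zero]⟩
  exact h ⟨1, trivial, by simp⟩

/-- The exponential map `𝔰𝔬(p,q) → SO°(p,q)`. -/
def expG (X : so p q) : G p q := ⟨(expSO X).1, ⟨expSO X, expSO_mem X, rfl⟩⟩

theorem mat_expG (X : so p q) : mat (expG X) = exp X.1 := rfl

theorem mat_injective : Function.Injective (mat : G p q → _) := fun _ _ h =>
  Subtype.ext (Subtype.ext h)

theorem continuous_expG : Continuous (expG : so p q → G p q) :=
  Continuous.subtype_mk (continuous_subtype_val.comp continuous_expSO) _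

theorem continuous_mat : Continuous (mat : G p q → _) :=
  continuous_subtype_val.comp continuous_subtype_val

theorem expG_zero : expG (0 : so p q) = 1 := mat_injective NormedSpace.exp_zero

theorem expG_add_smul (X : so p q) (s t : ℝ) :
    expG ((s + t) • X) = expG (s • X) * expG (t • X) := by
  apply mat_injective
  rw [mat_mul, mat_expG, mat_expG, mat_expG, ← Matrix.exp_add_of_commute]
  · simp [add_smul]
  · exact ((Commute.refl X.1).smul_left s).smul_right t

theorem expG_neg_smul (X : so p q) (t : ℝ) : expG ((-t) • X) = (expG (t • X))⁻¹ := by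
  rw [eq_inv_iff_mul_eq_one, ← expG_add_smul]; simp [expG_zero]

theorem mat_orthogonal (g : G p q) : mat g * Ipq p q * (mat g)ᵀ = Ipq p q := by
  obtain ⟨h, -, hh⟩ := g.2
  have := h.2
  have e : mat g = h.1.1 := congrArg Subtype.val hh.symm
  rw [e]; exact this

theorem mat_mul_mat_inv (g : G p q) : mat g * mat g⁻¹ = 1 := by
  rw [← mat_mul, mul_inv_cancel, mat_one]

theorem mat_inv_mul_mat (g : G p q) : mat g⁻¹ * mat g = 1 := by
  rw [← mat_mul, inv_mul_cancel, mat_one]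

theorem mat_inv (g : G p q) : mat g⁻¹ = Ipq p q * (mat g)ᵀ * Ipq p q :=
  left_inv_eq_right_inv (mat_inv_mul_mat g) (orthogonal_iff.1 (mat_orthogonal g))

theorem conj_mem_so (g : G p q) {X : Matrix (Fin p ⊕ Fin q) (Fin p ⊕ Fin q) ℝ} (hX : X ∈ so p q) :
    mat g * X * mat g⁻¹ ∈ so p q := by
  rw [mem_so_iff_conj] at *
  have h1 : Ipq p q * (mat g⁻¹)ᵀ * Ipq p q = mat g := by
    rw [← mat_inv, inv_inv]
  calc Ipq p q * (mat g * X * mat g⁻¹)ᵀ * Ipq p q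
      = Ipq p q * (mat g⁻¹)ᵀ * (Ipq p q * Ipq p q) * Xᵀ * (Ipq p q * Ipq p q) * (mat g)ᵀ *
          Ipq p q := by
        simp only [transpose_mul, Ipq_mul_self, Matrix.mul_one, Matrix.mul_assoc]
    _ = (Ipq p q * (mat g⁻¹)ᵀ * Ipq p q) * (Ipq p q * Xᵀ * Ipq p q) *
        (Ipq p q * (mat g)ᵀ * Ipq p q) := by simp only [Matrix.mul_assoc]
    _ = _ := by rw [h1, hX, ← mat_inv]; simp

/-- The adjoint action of `SO°(p,q)` on its Lie algebra. -/
def Ad (g : G p q) : so p q →ₗ[ℝ] so p q where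
  toFun X := ⟨mat g * X.1 * mat g⁻¹, conj_mem_so g X.2⟩
  map_add' X Y := by
    apply Subtype.ext; simp [Matrix.mul_add, Matrix.add_mul]
  map_smul' c X := by
    apply Subtype.ext; simp

theorem coe_Ad (g : G p q) (X : so p q) : (Ad g X).1 = mat g * X.1 * mat g⁻¹ := rfl

theorem conj_expG (g : G p q) (X : so p q) : g * expG X * g⁻¹ = expG (Ad g X) := by
  apply mat_injective
  have hu : IsUnit (mat g) := ⟨⟨_, _, mat_mul_mat_inv g, mat_inv_mul_mat g⟩, rfl⟩
  have hinv : (mat g)⁻¹ = mat g⁻¹ := Matrix.inv_eq_left_inv (mat_inv_mul_mat g)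
  rw [mat_mul, mat_mul, mat_expG, mat_expG, coe_Ad, ← hinv, Matrix.exp_conj _ _ hu]

end LieAlgebra

/-! ### Rotations and boosts in coordinate planes -/

section PlaneGenerators

open NormedSpace Matrix

variable {p q : ℕ}

theorem planeGen_mem (i j : Fin p ⊕ Fin q) :
    single i j (sgn p q j) - single j i (sgn p q i) ∈ so p q := by
  have h1 : ∀ i j : Fin p ⊕ Fin q, single i j (sgn p q j) * diagonal (sgn p q) = single i j 1 := by
    intro i j; ext a b
    rw [mul_diagonal, single_apply, single_apply]
    split_ifs with h
    · rw [← h.2, sgn_mul_self]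
    · rw [zero_mul]
  have h2 : ∀ i j : Fin p ⊕ Fin q, diagonal (sgn p q) * single i j (sgn p q i) = single i j 1 := by
    intro i j; ext a b
    rw [diagonal_mul, single_apply, single_apply]
    split_ifs with h
    · rw [← h.1, sgn_mul_self]
    · rw [mul_zero]
  rw [mem_so, Ipq_eq_diagonal, Matrix.sub_mul, transpose_sub, transpose_single, transpose_single,
    Matrix.mul_sub, h1, h1, h2, h2]
  abel

/-- The generator of the one-parameter group that moves the coordinate plane of `i` and `j`: a
rotation if `i` and `j` lie in the same block, and a boost if they do not. -/
def planeGen (i j : Fin p ⊕ Fin q) : so p q := ⟨_, planeGen_mem i j⟩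

theorem coe_planeGen (i j : Fin p ⊕ Fin q) :
    (planeGen i j).1 = single i j (sgn p q j) - single j i (sgn p q i) := rfl

theorem planeGen_self (i : Fin p ⊕ Fin q) : planeGen i i = 0 := by
  apply Subtype.ext; rw [coe_planeGen, sub_self]; rfl

theorem planeGen_swap (i j : Fin p ⊕ Fin q) : planeGen j i = -planeGen i j := by
  apply Subtype.ext
  rw [Submodule.coe_neg, coe_planeGen, coe_planeGen, neg_sub]

theorem planeGen_bracket {i j k : Fin p ⊕ Fin q} (hij : i ≠ j) (hjk : j ≠ k) (hik : i ≠ k) :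
    (planeGen i j).1 * (planeGen j k).1 - (planeGen j k).1 * (planeGen i j).1 =
      sgn p q j • (planeGen i k).1 := by
  simp only [coe_planeGen, Matrix.mul_sub, Matrix.sub_mul, smul_sub, smul_single]
  simp [hij, hjk, hik, hij.symm, hjk.symm, hik.symm, mul_comm]

theorem mem_span_planeGen (X : so p q) :
    X ∈ Submodule.span ℝ (Set.range fun z : (Fin p ⊕ Fin q) × (Fin p ⊕ Fin q) =>
      planeGen z.1 z.2) := by
  have h : X = ∑ i, ∑ j, (2⁻¹ * X.1 i j * sgn p q j) • planeGen i j := by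
    apply Subtype.ext
    ext a b
    have hX := congrFun (congrFun (mem_so.1 X.2) a) b
    rw [Ipq_eq_diagonal] at hX
    simp only [Matrix.add_apply, mul_diagonal, diagonal_mul, Matrix.transpose_apply,
      Matrix.zero_apply] at hX
    have hb := sgn_mul_self (p := p) (q := q) b
    simp only [AddSubmonoidClass.coe_finsetSum, Submodule.coe_smul, coe_planeGen, Matrix.sum_apply,
      Matrix.smul_apply, Matrix.sub_apply, single_apply, smul_eq_mul, mul_sub,
      Finset.sum_sub_distrib, ite_and, mul_ite, mul_zero]
    simp only [Finset.sum_ite_eq', Finset.mem_univ, if_true,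
      Finset.sum_ite_irrel, Finset.sum_const_zero]
    linear_combination (-X.1 a b) * hb + (sgn p q b) / 2 * hX
  rw [h]
  exact Submodule.sum_mem _ fun i _ => Submodule.sum_mem _ fun j _ =>
    Submodule.smul_mem _ _ (Submodule.subset_span ⟨(i, j), rfl⟩)

section Rotation
open scoped Matrix.Norms.Operator

theorem hasDerivAt_exp_smul (X : Matrix (Fin p ⊕ Fin q) (Fin p ⊕ Fin q) ℝ) (t : ℝ) :
    HasDerivAt (fun u : ℝ => exp (u • X)) (exp (t • X) * X) t :=
  hasDerivAt_exp_smul_const X t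

/-- Rodrigues' formula. It makes half turns and quarter turns explicit. -/
theorem exp_smul_of_cube {X : Matrix (Fin p ⊕ Fin q) (Fin p ⊕ Fin q) ℝ} (hX : X * X * X = -X)
    (t : ℝ) : exp (t • X) = 1 + Real.sin t • X + (1 - Real.cos t) • (X * X) := by
  -- the product of `exp (-tX)` with the right-hand side has derivative zero
  have hd : ∀ t : ℝ, HasDerivAt (fun u : ℝ => exp (u • (-X)) *
      (1 + Real.sin u • X + (1 - Real.cos u) • (X * X))) 0 t := by
    intro t
    have h1 : HasDerivAt (fun u : ℝ => 1 + Real.sin u • X + (1 - Real.cos u) • (X * X))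
        (Real.cos t • X + Real.sin t • (X * X)) t := by
      have h2 := ((Real.hasDerivAt_sin t).smul_const X).const_add 1
      have h3 := ((Real.hasDerivAt_cos t).const_sub 1).smul_const (X * X)
      exact (h2.add h3).congr_deriv (by simp)
    have h4 := (hasDerivAt_exp_smul (-X) t).mul h1
    refine h4.congr_deriv ?_
    rw [Matrix.mul_assoc, ← Matrix.mul_add]
    have : -X * (1 + Real.sin t • X + (1 - Real.cos t) • (X * X)) +
        (Real.cos t • X + Real.sin t • (X * X)) = 0 := by
      simp only [Matrix.mul_add, Matrix.mul_one, Matrix.mul_smul, Matrix.neg_mul,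
        ← Matrix.mul_assoc, hX]
      module
    rw [this, Matrix.mul_zero]
  have hc := is_const_of_deriv_eq_zero (fun t => (hd t).differentiableAt) (fun t => (hd t).deriv)
    t 0
  simp only [zero_smul, NormedSpace.exp_zero, Real.sin_zero, Real.cos_zero, sub_self, add_zero,
    Matrix.mul_one] at hc
  have h5 : exp (t • X) * exp (t • (-X)) = 1 := by
    rw [smul_neg, ← Matrix.exp_add_of_commute _ (-(t • X)) (Commute.refl (t • X)).neg_right,
      add_neg_cancel, NormedSpace.exp_zero]
  have h6 := congrArg (exp (t • X) * ·) hc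
  simp only [← Matrix.mul_assoc, h5, Matrix.one_mul, Matrix.mul_one] at h6
  exact h6.symm

end Rotation

theorem planeGen_sq {k l : Fin p ⊕ Fin q} (hkl : k ≠ l) (hs : sgn p q k = sgn p q l) :
    (planeGen k l).1 * (planeGen k l).1 = -single k k 1 - single l l 1 := by
  have h := sgn_mul_self (p := p) (q := q) l
  simp only [coe_planeGen, Matrix.mul_sub, Matrix.sub_mul]
  simp [hkl, hkl.symm, hs, h]
  abel

theorem planeGen_cube {k l : Fin p ⊕ Fin q} (hkl : k ≠ l) (hs : sgn p q k = sgn p q l) :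
    (planeGen k l).1 * (planeGen k l).1 * (planeGen k l).1 = -(planeGen k l).1 := by
  rw [planeGen_sq hkl hs]
  simp only [coe_planeGen, Matrix.mul_sub, Matrix.sub_mul, Matrix.neg_mul]
  simp [hkl, hkl.symm, hs]
  abel

theorem mat_expG_rotation {k l : Fin p ⊕ Fin q} (hkl : k ≠ l) (hs : sgn p q k = sgn p q l)
    (t : ℝ) : mat (expG (t • planeGen k l)) = 1 + Real.sin t • (planeGen k l).1 +
      (1 - Real.cos t) • (-single k k 1 - single l l 1) := by
  rw [mat_expG, Submodule.coe_smul, exp_smul_of_cube (planeGen_cube hkl hs), planeGen_sq hkl hs]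

/-- The half turn in the coordinate plane of two indices `k` and `l` of the same block. (For `k`
and `l` in different blocks the formula gives a boost, which is not used.) -/
def halfTurn (k l : Fin p ⊕ Fin q) : G p q := expG (Real.pi • planeGen k l)

/-- The rotation by a right angle in the coordinate plane of two indices of the same block. Up to
signs it exchanges the two coordinates. -/
def quarterTurn (k l : Fin p ⊕ Fin q) : G p q := expG ((Real.pi / 2) • planeGen k l)

/-- The diagonal entries of the half turn in the plane of `k` and `l`. -/
def turnSign (k l i : Fin p ⊕ Fin q) : ℝ := if i = k ∨ i = l then -1 else 1

theorem mat_halfTurn {k l : Fin p ⊕ Fin q} (hkl : k ≠ l) (hs : sgn p q k = sgn p q l) :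
    mat (halfTurn k l) = diagonal (turnSign k l) := by
  rw [halfTurn, mat_expG_rotation hkl hs]
  ext a b
  simp only [Real.sin_pi, Real.cos_pi, Matrix.add_apply, Matrix.smul_apply, Matrix.sub_apply,
    Matrix.neg_apply, single_apply, diagonal_apply, turnSign, Matrix.one_apply]
  by_cases hab : a = b
  · subst hab
    by_cases h1 : a = k
    · subst h1; simp [hkl.symm]
    · by_cases h2 : a = l
      · subst h2; simp [hkl]
      · simp [h1, h2, Ne.symm h1, Ne.symm h2]
  · have h1 : ¬ (k = a ∧ k = b) := fun h => hab (h.1.symm.trans h.2)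
    have h2 : ¬ (l = a ∧ l = b) := fun h => hab (h.1.symm.trans h.2)
    simp [hab, h1, h2]

theorem mat_quarterTurn_apply_eq_zero {k l : Fin p ⊕ Fin q} (hkl : k ≠ l)
    (hs : sgn p q k = sgn p q l) {a b : Fin p ⊕ Fin q} (hab : a ≠ Equiv.swap k l b) :
    mat (quarterTurn k l) a b = 0 := by
  rw [quarterTurn, mat_expG_rotation hkl hs]
  simp only [Real.sin_pi_div_two, Real.cos_pi_div_two, Matrix.add_apply, Matrix.smul_apply,
    Matrix.sub_apply, Matrix.neg_apply, single_apply, coe_planeGen, Matrix.one_apply]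
  by_cases h1 : b = k
  · subst h1
    rw [Equiv.swap_apply_left] at hab
    by_cases h2 : a = b
    · subst h2; simp [hkl.symm]
    · simp [h2, hab.symm, Ne.symm h2]
  · by_cases h3 : b = l
    · subst h3
      rw [Equiv.swap_apply_right] at hab
      by_cases h2 : a = b
      · subst h2; simp [hkl]
      · simp [h2, hab.symm, Ne.symm h2]
    · rw [Equiv.swap_apply_of_ne_of_ne h1 h3] at hab
      simp [hab, Ne.symm h1, Ne.symm h3]

theorem turnSign_swap {k l : Fin p ⊕ Fin q} (i j b : Fin p ⊕ Fin q) :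
    turnSign (Equiv.swap k l i) (Equiv.swap k l j) (Equiv.swap k l b) = turnSign i j b := by
  simp [turnSign]

theorem sgn_swap {k l : Fin p ⊕ Fin q} (hs : sgn p q k = sgn p q l) (i : Fin p ⊕ Fin q) :
    sgn p q (Equiv.swap k l i) = sgn p q i := by
  rw [Equiv.swap_apply_def]; split_ifs with h1 h2
  · rw [h1, hs]
  · rw [h2, hs]
  · rfl

/-- Conjugation by a quarter turn permutes the half turns. -/
theorem quarterTurn_mul_halfTurn {k l : Fin p ⊕ Fin q} (hkl : k ≠ l) (hs : sgn p q k = sgn p q l)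
    {i j : Fin p ⊕ Fin q} (hij : i ≠ j) (hs' : sgn p q i = sgn p q j) :
    quarterTurn k l * halfTurn i j =
      halfTurn (Equiv.swap k l i) (Equiv.swap k l j) * quarterTurn k l := by
  apply mat_injective
  rw [mat_mul, mat_mul, mat_halfTurn hij hs', mat_halfTurn ((Equiv.swap k l).injective.ne hij)
    (by rw [sgn_swap hs, sgn_swap hs, hs'])]
  ext a b
  rw [mul_diagonal, diagonal_mul]
  by_cases hab : a = Equiv.swap k l b
  · rw [hab, turnSign_swap, mul_comm]
  · rw [mat_quarterTurn_apply_eq_zero hkl hs hab, zero_mul, mul_zero]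

theorem halfTurn_mul_halfTurn_comm {k l i j : Fin p ⊕ Fin q} (hkl : k ≠ l)
    (hs : sgn p q k = sgn p q l) (hij : i ≠ j) (hs' : sgn p q i = sgn p q j) :
    halfTurn k l * halfTurn i j = halfTurn i j * halfTurn k l := by
  apply mat_injective
  rw [mat_mul, mat_mul, mat_halfTurn hij hs', mat_halfTurn hkl hs, diagonal_mul_diagonal,
    diagonal_mul_diagonal]
  simp only [mul_comm]

theorem halfTurn_mul_self {k l : Fin p ⊕ Fin q} (hkl : k ≠ l) (hs : sgn p q k = sgn p q l) :
    halfTurn k l * halfTurn k l = 1 := by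
  apply mat_injective
  rw [mat_mul, mat_halfTurn hkl hs, diagonal_mul_diagonal, mat_one, ← diagonal_one]
  congr 1; funext i; simp only [turnSign]; split_ifs <;> norm_num

theorem halfTurn_mul_halfTurn {k l m : Fin p ⊕ Fin q} (hkl : k ≠ l) (hlm : l ≠ m) (hkm : k ≠ m)
    (hs : sgn p q k = sgn p q l) (hs' : sgn p q l = sgn p q m) :
    halfTurn k l * halfTurn l m = halfTurn k m := by
  apply mat_injective
  rw [mat_mul, mat_halfTurn hkl hs, mat_halfTurn hlm hs', mat_halfTurn hkm (hs.trans hs'),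
    diagonal_mul_diagonal]
  congr 1; funext i; simp only [turnSign]
  by_cases h1 : i = k
  · subst h1; simp [hkl, hkm]
  · by_cases h2 : i = l
    · subst h2; simp [hkl.symm, hlm]
    · simp [h1, h2]

/-- A diagonal element of `SO°(p,q)` multiplies each plane generator by a sign. -/
theorem Ad_planeGen_of_diagonal {d : G p q} {δ : Fin p ⊕ Fin q → ℝ} (hd : mat d = diagonal δ)
    (hδ : ∀ i, δ i * δ i = 1) (i j : Fin p ⊕ Fin q) :
    Ad d (planeGen i j) = (δ i * δ j) • planeGen i j := by
  have hinv : mat d⁻¹ = diagonal δ := by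
    refine left_inv_eq_right_inv (mat_inv_mul_mat d) ?_
    rw [hd, diagonal_mul_diagonal, ← diagonal_one]
    congr 1; funext i; exact hδ i
  apply Subtype.ext
  rw [coe_Ad, hinv, hd, Submodule.coe_smul, coe_planeGen]
  ext a b
  simp only [mul_diagonal, diagonal_mul, Matrix.sub_apply, Matrix.smul_apply, single_apply,
    smul_eq_mul]
  split_ifs with h1 h2 h2
  · obtain ⟨rfl, rfl⟩ := h1; obtain ⟨rfl, -⟩ := h2; ring
  · obtain ⟨rfl, rfl⟩ := h1; ring
  · obtain ⟨rfl, rfl⟩ := h2; ring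
  · ring

theorem turnSign_mul_self (k l i : Fin p ⊕ Fin q) : turnSign k l i * turnSign k l i = 1 := by
  simp only [turnSign]; split_ifs <;> norm_num

theorem Ad_halfTurn {k l : Fin p ⊕ Fin q} (hkl : k ≠ l) (hs : sgn p q k = sgn p q l)
    (i j : Fin p ⊕ Fin q) :
    Ad (halfTurn k l) (planeGen i j) = (turnSign k l i * turnSign k l j) • planeGen i j :=
  Ad_planeGen_of_diagonal (mat_halfTurn hkl hs) (turnSign_mul_self k l) i j

/-- Rotations inside a block lie in `K`. -/
theorem expG_rotation_mem_K {k l : Fin p ⊕ Fin q} (hs : sgn p q k = sgn p q l)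
    (t : ℝ) : expG (t • planeGen k l) ∈ K p q := by
  rcases eq_or_ne k l with rfl | hkl
  · rw [planeGen_self, smul_zero, expG_zero]; exact one_mem _
  set g := expG (t • planeGen k l) with hg
  -- a rotation moves one block only, so the two diagonal blocks of its matrix suffice
  have h12 : (mat g).toBlocks₁₂ = 0 := by
    ext a b
    rw [hg, mat_expG_rotation hkl hs]
    rcases k with k | k <;> rcases l with l | l
    · simp [toBlocks₁₂, coe_planeGen]
    · norm_num [sgn] at hs
    · norm_num [sgn] at hs
    · simp [toBlocks₁₂, coe_planeGen]
  have h21 : (mat g).toBlocks₂₁ = 0 := by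
    ext a b
    rw [hg, mat_expG_rotation hkl hs]
    rcases k with k | k <;> rcases l with l | l
    · simp [toBlocks₂₁, coe_planeGen]
    · norm_num [sgn] at hs
    · norm_num [sgn] at hs
    · simp [toBlocks₂₁, coe_planeGen]
  have hone : (mat g).toBlocks₁₁ = 1 ∨ (mat g).toBlocks₂₂ = 1 := by
    rw [hg, mat_expG_rotation hkl hs]
    rcases k with k | k <;> rcases l with l | l
    · right; ext a b
      simp [toBlocks₂₂, coe_planeGen, Matrix.one_apply]
    · norm_num [sgn] at hs
    · norm_num [sgn] at hs
    · left; ext a b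
      simp [toBlocks₁₁, coe_planeGen, Matrix.one_apply]
  have hb : mat g = fromBlocks (mat g).toBlocks₁₁ 0 0 (mat g).toBlocks₂₂ := by
    conv_lhs => rw [← fromBlocks_toBlocks (mat g), h12, h21]
  have ho := mat_orthogonal g
  have hdet : (mat g).toBlocks₁₁.det * (mat g).toBlocks₂₂.det = 1 := by
    have := g.1.2
    change (mat g).det = 1 at this
    rw [hb, det_fromBlocks_zero₂₁] at this
    exact this
  rw [hb, Ipq, fromBlocks_transpose, fromBlocks_multiply, fromBlocks_multiply] at ho
  simp only [Matrix.mul_zero, Matrix.zero_mul, add_zero, zero_add, transpose_zero, Matrix.mul_neg,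
    Matrix.mul_one, Matrix.neg_mul, neg_zero] at ho
  obtain ⟨h1, -, -, h2⟩ := fromBlocks_inj.1 ho
  refine ⟨_, ?_, _, ?_, hb⟩
  · rw [mem_specialOrthogonalGroup_iff, mem_orthogonalGroup_iff]
    refine ⟨by simpa [star_eq_conjTranspose] using h1, ?_⟩
    rcases hone with h | h
    · rw [h, det_one]
    · rwa [h, det_one, mul_one] at hdet
  · rw [mem_specialOrthogonalGroup_iff, mem_orthogonalGroup_iff]
    refine ⟨by simpa [star_eq_conjTranspose] using h2, ?_⟩
    rcases hone with h | h
    · rwa [h, det_one, one_mul] at hdet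
    · rw [h, det_one]

end PlaneGenerators

/-! ### Generation by one-parameter groups -/

section Generators

open NormedSpace Matrix

variable {p q : ℕ}

theorem hasStrictFDerivAt_list_prod_exp {ι 𝔸 : Type*} [Fintype ι] [NormedRing 𝔸]
    [NormedAlgebra ℝ 𝔸] [CompleteSpace 𝔸] (Y : ι → 𝔸) (l : List ι) :
    HasStrictFDerivAt (fun t : ι → ℝ => (l.map fun i => exp (t i • Y i)).prod)
      (l.map fun i => (ContinuousLinearMap.proj (R := ℝ) (φ := fun _ : ι => ℝ) i).smulRight
        (Y i)).sum 0 := by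
  induction l with
  | nil => simpa using hasStrictFDerivAt_const (1 : 𝔸) (0 : ι → ℝ)
  | cons i l ih =>
    have h1 : HasStrictFDerivAt (fun t : ι → ℝ => exp (t i • Y i))
        ((ContinuousLinearMap.proj (R := ℝ) (φ := fun _ : ι => ℝ) i).smulRight (Y i)) 0 := by
      have h2 : HasStrictFDerivAt (fun t : ι → ℝ => t i • Y i)
          ((ContinuousLinearMap.proj (R := ℝ) (φ := fun _ : ι => ℝ) i).smulRight (Y i)) 0 :=
        ((ContinuousLinearMap.proj (R := ℝ) (φ := fun _ : ι => ℝ) i).smulRight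
          (Y i)).hasStrictFDerivAt
      have h3 : HasStrictFDerivAt (exp : 𝔸 → 𝔸) (1 : 𝔸 →L[ℝ] 𝔸) ((0 : ι → ℝ) i • Y i) := by
        rw [Pi.zero_apply, zero_smul]; exact hasStrictFDerivAt_exp_zero
      exact h3.comp (0 : ι → ℝ) h2
    have h4 := h1.mul' ih
    simp only [List.map_cons, List.prod_cons, List.sum_cons]
    refine h4.congr_fderiv ?_
    have h5 : (l.map fun i => exp ((0 : ι → ℝ) i • Y i)).prod = 1 := by
      apply List.prod_eq_one; simp
    rw [h5]
    ext t
    simp [add_comm]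

/-- `Z ↦ Z + I_{p,q} Zᵀ I_{p,q}`. Its values form a complement of `𝔰𝔬(p,q)` in the space of
matrices. -/
def symPart (p q : ℕ) : Matrix (Fin p ⊕ Fin q) (Fin p ⊕ Fin q) ℝ →ₗ[ℝ]
    Matrix (Fin p ⊕ Fin q) (Fin p ⊕ Fin q) ℝ where
  toFun Z := Z + Ipq p q * Zᵀ * Ipq p q
  map_add' X Y := by simp only [transpose_add, Matrix.mul_add, Matrix.add_mul]; abel
  map_smul' c X := by simp

theorem symPart_apply (Z : Matrix (Fin p ⊕ Fin q) (Fin p ⊕ Fin q) ℝ) :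
    symPart p q Z = Z + Ipq p q * Zᵀ * Ipq p q := rfl

theorem Ipq_conj_conj (Z : Matrix (Fin p ⊕ Fin q) (Fin p ⊕ Fin q) ℝ) :
    Ipq p q * (Ipq p q * Zᵀ * Ipq p q)ᵀ * Ipq p q = Z := by
  rw [transpose_mul, transpose_mul, transpose_transpose, Ipq_transpose]
  simp only [← Matrix.mul_assoc, Ipq_mul_self, Matrix.one_mul]
  rw [Matrix.mul_assoc, Ipq_mul_self, Matrix.mul_one]

theorem symPart_conj (Z : Matrix (Fin p ⊕ Fin q) (Fin p ⊕ Fin q) ℝ) :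
    Ipq p q * (symPart p q Z)ᵀ * Ipq p q = symPart p q Z := by
  rw [symPart_apply, transpose_add, Matrix.mul_add, Matrix.add_mul, Ipq_conj_conj, add_comm]

theorem exists_mem_so_add_symPart (M : Matrix (Fin p ⊕ Fin q) (Fin p ⊕ Fin q) ℝ) :
    ∃ X : so p q, ∃ Z, M = X.1 + symPart p q Z := by
  refine ⟨⟨(2⁻¹ : ℝ) • (M - Ipq p q * Mᵀ * Ipq p q), (so p q).smul_mem _ ?_⟩, (2⁻¹ : ℝ) • M, ?_⟩
  · rw [mem_so_iff_conj, transpose_sub, Matrix.mul_sub, Matrix.sub_mul, Ipq_conj_conj, neg_sub]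
  · rw [map_smul, symPart_apply]
    dsimp only
    module

section Generation
open scoped Matrix.Norms.Operator

/-- The products of exponentials from a set that spans the Lie algebra cover a neighbourhood of
`1` in `SO(p,q)`. -/
theorem eventually_mem_of_span (H : Subgroup (G p q))
    (hH : Submodule.span ℝ {X : so p q | ∀ t : ℝ, expG (t • X) ∈ H} = ⊤) :
    ∀ᶠ g : SOpq p q in 𝓝 1, ∃ h ∈ H, h.1 = g.1 := by
  obtain ⟨b, hbL, hspan, hli⟩ := exists_linearIndependent ℝ
    {X : so p q | ∀ t : ℝ, expG (t • X) ∈ H}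
  rw [hH] at hspan
  have : Fintype b := (LinearIndependent.setFinite hli).fintype
  set P : (b → ℝ) → Matrix (Fin p ⊕ Fin q) (Fin p ⊕ Fin q) ℝ :=
    fun t => (Finset.univ.toList.map fun i : b => exp (t i • i.1.1)).prod with hP
  have hPH : ∀ t, ∃ h ∈ H, mat h = P t := by
    intro t
    rw [hP]
    induction (Finset.univ : Finset b).toList with
    | nil => exact ⟨1, one_mem _, rfl⟩
    | cons i l ih =>
      obtain ⟨h, hh, e⟩ := ih
      refine ⟨expG (t i • i.1) * h, mul_mem (hbL i.2 _) hh, ?_⟩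
      rw [mat_mul, e, mat_expG]; simp
  have hP0 : P 0 = 1 := by
    apply List.prod_eq_one; simp
  have hPd := hasStrictFDerivAt_list_prod_exp (fun i : b => i.1.1) Finset.univ.toList
  rw [Finset.sum_map_toList] at hPd
  set D : (b → ℝ) →L[ℝ] Matrix (Fin p ⊕ Fin q) (Fin p ⊕ Fin q) ℝ :=
    ∑ i : b, (ContinuousLinearMap.proj (R := ℝ) (φ := fun _ : b => ℝ) i).smulRight i.1.1 with hD
  have hD' : ∀ t, D t = ∑ i, t i • i.1.1 := by
    intro t; simp [hD]
  set σ : Matrix (Fin p ⊕ Fin q) (Fin p ⊕ Fin q) ℝ →L[ℝ]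
    Matrix (Fin p ⊕ Fin q) (Fin p ⊕ Fin q) ℝ := LinearMap.toContinuousLinearMap (symPart p q)
  have hσ : ∀ Z, σ Z = symPart p q Z := fun _ => rfl
  set Ψ : (b → ℝ) × Matrix (Fin p ⊕ Fin q) (Fin p ⊕ Fin q) ℝ →
    Matrix (Fin p ⊕ Fin q) (Fin p ⊕ Fin q) ℝ := fun z => P z.1 * (1 + σ z.2) with hΨ
  have hΨd : HasStrictFDerivAt Ψ (D.coprod σ) 0 := by
    have h1 : HasStrictFDerivAt (fun z : (b → ℝ) × Matrix (Fin p ⊕ Fin q) (Fin p ⊕ Fin q) ℝ =>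
        P z.1) (D.comp (ContinuousLinearMap.fst ℝ _ _)) 0 :=
      HasStrictFDerivAt.comp 0 (g := P) hPd hasStrictFDerivAt_fst
    have h2 : HasStrictFDerivAt (fun z : (b → ℝ) × Matrix (Fin p ⊕ Fin q) (Fin p ⊕ Fin q) ℝ =>
        1 + σ z.2) (σ.comp (ContinuousLinearMap.snd ℝ _ _)) 0 := by
      have h3 := (σ.comp (ContinuousLinearMap.snd ℝ (b → ℝ)
        (Matrix (Fin p ⊕ Fin q) (Fin p ⊕ Fin q) ℝ))).hasStrictFDerivAt (x := 0)
      exact h3.const_add 1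
    refine (h1.mul' h2).congr_fderiv ?_
    refine ContinuousLinearMap.ext fun z => ?_
    change P 0 * σ z.2 + D z.1 * (1 + σ 0) = D z.1 + σ z.2
    rw [hP0, map_zero, add_zero, one_mul, mul_one, add_comm]
  have hsurj : LinearMap.range (D.coprod σ).toLinearMap = ⊤ := by
    rw [LinearMap.range_eq_top]
    intro M
    obtain ⟨X, Z, rfl⟩ := exists_mem_so_add_symPart M
    have hX : X ∈ Submodule.span ℝ (Set.range fun i : b => i.1) := by
      rw [Subtype.range_coe_subtype, Set.ofPred_mem_eq, hspan]; trivial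
    obtain ⟨c, hc⟩ := (Submodule.mem_span_range_iff_exists_fun ℝ).1 hX
    refine ⟨(c, Z), ?_⟩
    rw [ContinuousLinearMap.coe_coe, ContinuousLinearMap.coprod_apply, hD', hσ, ← hc]
    simp
  have hmap := hΨd.map_nhds_eq_of_surj hsurj
  have hΨ0 : Ψ 0 = 1 := by
    simp only [hΨ, Prod.fst_zero, Prod.snd_zero, hP0, map_zero, add_zero, mul_one]
  rw [hΨ0] at hmap
  -- close to the origin `2 + Y` is invertible, where `Y` is the symmetric part
  have hunit : ∀ᶠ z : (b → ℝ) × Matrix (Fin p ⊕ Fin q) (Fin p ⊕ Fin q) ℝ in 𝓝 0,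
      (1 + 1 + σ z.2).det ≠ 0 := by
    have hc : Continuous fun z : (b → ℝ) × Matrix (Fin p ⊕ Fin q) (Fin p ⊕ Fin q) ℝ =>
        (1 + 1 + σ z.2).det := by fun_prop
    refine hc.continuousAt.eventually_ne ?_
    have h2 : (1 + 1 : Matrix (Fin p ⊕ Fin q) (Fin p ⊕ Fin q) ℝ) = (2 : ℝ) • 1 := by
      rw [two_smul]
    simp only [Prod.snd_zero, map_zero, add_zero, h2, det_smul, det_one, mul_one]
    positivity
  have hev : ∀ᶠ M in 𝓝 (1 : Matrix (Fin p ⊕ Fin q) (Fin p ⊕ Fin q) ℝ),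
      ∃ z, (1 + 1 + σ z.2).det ≠ 0 ∧ Ψ z = M := by
    have h1 : ∀ᶠ M in Filter.map Ψ (𝓝 0), ∃ z, (1 + 1 + σ z.2).det ≠ 0 ∧ Ψ z = M :=
      Filter.eventually_map.2 (hunit.mono fun z hz => ⟨z, hz, rfl⟩)
    exact h1.filter_mono hmap.ge
  have hcont : Continuous fun g : SOpq p q => g.1.1 :=
    continuous_subtype_val.comp continuous_subtype_val
  have hev' := (hcont.continuousAt (x := 1)).eventually hev
  filter_upwards [hev'] with g hg
  obtain ⟨⟨t, Z⟩, hdet, hz⟩ := hg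
  obtain ⟨h, hh, e⟩ := hPH t
  refine ⟨h, hh, Subtype.ext ?_⟩
  change mat h = g.1.1
  -- the element `u = 1 + Y` of `SO(p,q)` is its own inverse, so `Y (2 + Y) = 0`
  set Y := σ Z with hY
  have hu : mat h⁻¹ * g.1.1 = 1 + Y := by
    rw [← hz]
    simp only [hΨ]
    rw [← e, ← Matrix.mul_assoc, mat_inv_mul_mat, Matrix.one_mul]
  have ho : (1 + Y) * Ipq p q * (1 + Y)ᵀ = Ipq p q := by
    rw [← hu, transpose_mul]
    calc mat h⁻¹ * g.1.1 * Ipq p q * ((g.1.1)ᵀ * (mat h⁻¹)ᵀ)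
        = mat h⁻¹ * (g.1.1 * Ipq p q * (g.1.1)ᵀ) * (mat h⁻¹)ᵀ := by
          simp only [Matrix.mul_assoc]
      _ = Ipq p q := by
          have : g.1.1 * Ipq p q * (g.1.1)ᵀ = Ipq p q := g.2
          rw [this, mat_orthogonal]
  have hconj : Ipq p q * (1 + Y)ᵀ * Ipq p q = 1 + Y := by
    rw [transpose_add, Matrix.mul_add, Matrix.add_mul, transpose_one, Matrix.mul_one,
      Ipq_mul_self, hY, hσ, symPart_conj]
  rw [orthogonal_iff, hconj] at ho
  have hzero : (1 + 1 + Y) * Y = 0 := by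
    have : (1 + 1 + Y) * Y = (1 + Y) * (1 + Y) - 1 := by noncomm_ring
    rw [this, ho, sub_self]
  have hY0 : Y = 0 := by
    have h3 := congrArg ((1 + 1 + Y)⁻¹ * ·) hzero
    simpa only [← Matrix.mul_assoc, Matrix.nonsing_inv_mul _ (Ne.isUnit hdet), Matrix.one_mul,
      Matrix.mul_zero] using h3
  rw [← hz]
  simp only [hΨ]
  rw [← e, ← hY, hY0, add_zero, Matrix.mul_one]

end Generation

/-- A subgroup that contains the one-parameter groups of a set spanning `𝔰𝔬(p,q)` is all of
`SO°(p,q)`. -/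
theorem eq_top_of_span (H : Subgroup (G p q))
    (hH : Submodule.span ℝ {X : so p q | ∀ t : ℝ, expG (t • X) ∈ H} = ⊤) : H = ⊤ := by
  set H' : Subgroup (SOpq p q) := (H.map (G p q).subtype).comap (SOpq p q).subtype with hH'
  have hmem : ∀ g : SOpq p q, g ∈ H' ↔ ∃ h ∈ H, h.1 = g.1 := by
    intro g; simp only [hH', Subgroup.mem_comap, Subgroup.mem_map]; rfl
  have hnhds : (H' : Set (SOpq p q)) ∈ 𝓝 1 := by
    filter_upwards [eventually_mem_of_span H hH] with g hg using (hmem g).2 hg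
  have hopen : IsOpen (H' : Set (SOpq p q)) := Subgroup.isOpen_of_mem_nhds H' hnhds
  have hclopen : IsClopen (H' : Set (SOpq p q)) := ⟨Subgroup.isClosed_of_isOpen H' hopen, hopen⟩
  rw [eq_top_iff]
  intro g _
  obtain ⟨g', hg', e⟩ := g.2
  obtain ⟨h, hh, e'⟩ := (hmem g').1 (hclopen.connectedComponent_subset (one_mem H') hg')
  have : h = g := Subtype.ext (e'.trans e)
  rwa [← this]

theorem eq_top_of_planeGen (H : Subgroup (G p q))
    (hH : ∀ i j, i ≠ j → ∀ t : ℝ, expG (t • planeGen i j) ∈ H) : H = ⊤ := by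
  refine eq_top_of_span H (eq_top_iff.2 fun X _ => ?_)
  refine Submodule.span_mono ?_ (mem_span_planeGen X)
  rintro _ ⟨⟨i, j⟩, rfl⟩ t
  rcases eq_or_ne i j with rfl | hij
  · simp only [planeGen_self, smul_zero, expG_zero]; exact one_mem _
  · exact hH i j hij t

/-- A subspace of `𝔰𝔬(p,q)` that contains the orbit of `Y` under the one-parameter group of `X`
contains the bracket of `X` and `Y`, which is the derivative of a curve in that closed subspace. -/
theorem bracket_mem_of_Ad_mem (W : Submodule ℝ (so p q)) (X Y Z : so p q)
    (hW : ∀ t : ℝ, Ad (expG (t • X)) Y ∈ W) (hZ : Z.1 = X.1 * Y.1 - Y.1 * X.1) : Z ∈ W := by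
  open scoped Matrix.Norms.Operator in
  have hd : HasDerivAt (fun t : ℝ => (Ad (expG (t • X)) Y).1) Z.1 0 := by
    have h1 := hasDerivAt_exp_smul X.1 0
    have h2 := hasDerivAt_exp_smul (-X.1) 0
    have h3 := (h1.mul_const Y.1).mul h2
    have h4 : (fun t : ℝ => (Ad (expG (t • X)) Y).1) =
        fun t : ℝ => exp (t • X.1) * Y.1 * exp (t • (-X.1)) := by
      funext t
      rw [coe_Ad, ← expG_neg_smul, mat_expG, mat_expG]
      simp
    rw [h4]
    refine h3.congr_deriv ?_
    rw [hZ]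
    simp
    noncomm_ring
  set W' : Submodule ℝ (Matrix (Fin p ⊕ Fin q) (Fin p ⊕ Fin q) ℝ) := W.map (so p q).subtype
  have hW' : ∀ t : ℝ, (Ad (expG (t • X)) Y).1 ∈ W' := fun t => ⟨_, hW t, rfl⟩
  have hclosed : IsClosed (W' : Set (Matrix (Fin p ⊕ Fin q) (Fin p ⊕ Fin q) ℝ)) :=
    W'.closed_of_finiteDimensional
  have hslope := hd.tendsto_slope
  have hZW : Z.1 ∈ W' := by
    refine hclosed.mem_of_tendsto hslope (Filter.Eventually.of_forall fun t => ?_)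
    rw [slope_def_module]
    exact W'.smul_mem _ (W'.sub_mem (hW' _) (hW' _))
  obtain ⟨Z', hZ', e⟩ := hZW
  rwa [← Subtype.ext e]

end Generators

/-! ### Normal subgroups and perfectness -/

section NormalSubgroups

open Matrix

variable {p q : ℕ}

/-- Since the blocks have at least three indices, some index of the block of `i` differs from both
`i` and `j`. -/
theorem exists_third_index (hp : 3 ≤ p) (hq : 3 ≤ q) (i j : Fin p ⊕ Fin q) :
    ∃ l, i ≠ l ∧ j ≠ l ∧ sgn p q i = sgn p q l := by
  have key : ∀ m : ℕ, 3 ≤ m → ∀ s : Finset (Fin m), s.card ≤ 2 → ∃ l, l ∉ s := by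
    intro m hm s hs
    by_contra! h
    have : s = Finset.univ := Finset.eq_univ_iff_forall.2 h
    rw [this, Finset.card_univ, Fintype.card_fin] at hs
    omega
  rcases i with i | i
  · obtain ⟨l, hl⟩ := key p hp {i, Sum.elim id (fun _ => i) j} Finset.card_le_two
    rw [Finset.mem_insert, Finset.mem_singleton, not_or] at hl
    refine ⟨Sum.inl l, by simpa using Ne.symm hl.1, ?_, rfl⟩
    rcases j with j | j
    · simpa using Ne.symm hl.2
    · simp
  · obtain ⟨l, hl⟩ := key q hq {i, Sum.elim (fun _ => i) id j} Finset.card_le_two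
    rw [Finset.mem_insert, Finset.mem_singleton, not_or] at hl
    refine ⟨Sum.inr l, by simpa using Ne.symm hl.1, ?_, rfl⟩
    rcases j with j | j
    · simp
    · simpa using Ne.symm hl.2

theorem so_neg_one_smul (X : so p q) : (-1 : ℝ) • X = -X := by
  apply Subtype.ext; simp

theorem commutator_expG_of_Ad_eq_neg {d : G p q} {X : so p q} (hd : Ad d X = -X) (t : ℝ) :
    d * expG (t • X) * d⁻¹ * (expG (t • X))⁻¹ = expG ((-2 * t) • X) := by
  rw [conj_expG, map_smul, hd, ← expG_neg_smul, smul_neg, ← neg_smul, ← expG_add_smul]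
  congr 2; ring

/-- `SO°(p,q)` is perfect: it has no proper subgroup that contains all commutators. -/
theorem eq_top_of_commutator_mem (hp : 3 ≤ p) (hq : 3 ≤ q) (N : Subgroup (G p q))
    (hN : ∀ g h : G p q, g * h * g⁻¹ * h⁻¹ ∈ N) : N = ⊤ := by
  refine eq_top_of_planeGen N fun i j hij t => ?_
  -- a half turn that moves `i` but not `j` inverts the one-parameter group of the plane `i, j`
  obtain ⟨l, hil, hjl, hs⟩ := exists_third_index hp hq i j
  have hAd : Ad (halfTurn i l) (planeGen i j) = -planeGen i j := by
    rw [Ad_halfTurn hil hs]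
    have h : turnSign i l i * turnSign i l j = -1 := by simp [turnSign, hij.symm, hjl]
    rw [h, so_neg_one_smul]
  have h := commutator_expG_of_Ad_eq_neg hAd (-(t / 2))
  have h2 : -2 * -(t / 2) = t := by ring
  rw [h2] at h
  rw [← h]
  exact hN _ _

/-- A normal subgroup that contains a diagonal element other than `±1` is all of `SO°(p,q)`. -/
theorem eq_top_of_diagonal_mem (N : Subgroup (G p q)) [hN : N.Normal] {d : G p q} (hdN : d ∈ N)
    {δ : Fin p ⊕ Fin q → ℝ} (hd : mat d = diagonal δ) (hδ : ∀ i, δ i * δ i = 1)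
    {i j : Fin p ⊕ Fin q} (hij : δ i ≠ δ j) : N = ⊤ := by
  set W := Submodule.span ℝ {X : so p q | ∀ t : ℝ, expG (t • X) ∈ N} with hW
  have hAd : ∀ (g : G p q) (X : so p q), X ∈ W → Ad g X ∈ W := by
    intro g X hX
    have h : W ≤ W.comap (Ad g) := by
      rw [hW, Submodule.span_le]
      intro Y hY
      refine Submodule.subset_span fun t => ?_
      rw [← map_smul, ← conj_expG]
      exact hN.conj_mem _ (hY t) g
    exact h hX
  have hstep : ∀ a b c : Fin p ⊕ Fin q, a ≠ b → b ≠ c → a ≠ c → planeGen a b ∈ W →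
      planeGen a c ∈ W := by
    intro a b c hab hbc hac h
    have hb : sgn p q b • planeGen a c ∈ W := by
      have h' : -planeGen a b ∈ W := W.neg_mem h
      refine bracket_mem_of_Ad_mem W (planeGen b c) (-planeGen a b) _ (fun t => hAd _ _ h') ?_
      rw [Submodule.coe_smul, ← planeGen_bracket hab hbc hac, Submodule.coe_neg]
      simp only [Matrix.mul_neg, Matrix.neg_mul]
      abel
    have := W.smul_mem (sgn p q b) hb
    rwa [smul_smul, sgn_mul_self, one_smul] at this
  have hne : i ≠ j := fun h => hij (congrArg δ h)
  have h0 : planeGen i j ∈ W := by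
    refine Submodule.subset_span fun t => ?_
    have hδij : δ i * δ j = -1 := by
      have h1 := hδ i
      have h2 := hδ j
      have h3 : (δ i - δ j) * (δ i + δ j) = 0 := by linear_combination h1 - h2
      have h4 : δ i + δ j = 0 := (mul_eq_zero.1 h3).resolve_left (sub_ne_zero.2 hij)
      linear_combination δ i * h4 - h1
    have hneg : Ad d (planeGen i j) = -planeGen i j := by
      rw [Ad_planeGen_of_diagonal hd hδ, hδij, so_neg_one_smul]
    have h := commutator_expG_of_Ad_eq_neg hneg (-(t / 2))
    have h2 : -2 * -(t / 2) = t := by ring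
    rw [h2] at h
    rw [← h, mul_assoc, mul_assoc]
    refine N.mul_mem hdN ?_
    rw [← mul_assoc]
    exact hN.conj_mem _ (N.inv_mem hdN) _
  have hsymm : ∀ a b : Fin p ⊕ Fin q, planeGen a b ∈ W → planeGen b a ∈ W := fun a b h => by
    rw [planeGen_swap]; exact W.neg_mem h
  have h1 : ∀ k, k ≠ i → planeGen i k ∈ W := by
    intro k hk
    rcases eq_or_ne k j with rfl | hkj
    · exact h0
    · exact hstep i j k hne hkj.symm hk.symm h0
  have h2 : ∀ k l, planeGen k l ∈ W := by
    intro k l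
    rcases eq_or_ne k l with rfl | hkl
    · rw [planeGen_self]; exact W.zero_mem
    rcases eq_or_ne k i with rfl | hk
    · exact h1 l hkl.symm
    rcases eq_or_ne l i with rfl | hl
    · exact hsymm _ _ (h1 k hk)
    · exact hstep k i l hk hl.symm hkl (hsymm _ _ (h1 k hk))
  refine eq_top_of_span N (eq_top_iff.2 fun X _ => ?_)
  refine Submodule.span_le.2 ?_ (mem_span_planeGen X)
  rintro _ ⟨⟨k, l⟩, rfl⟩
  exact h2 k l

end NormalSubgroups

/-! ### Orbits of sign functions under permutations -/

section SignFunctions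

/-- A sign function on `m` points is spread if its orbit under the permutations, taken modulo a
global change of sign, has at least `m` elements. -/
def Spread {m : ℕ} (e : Fin m → ℤˣ) : Prop :=
  ∃ τ : Fin m → Equiv.Perm (Fin m), ∀ k k', k ≠ k' →
    e ∘ τ k ≠ e ∘ τ k' ∧ e ∘ τ k ≠ -(e ∘ τ k')

theorem Spread.neg {m : ℕ} {e : Fin m → ℤˣ} (h : Spread e) : Spread (-e) := by
  obtain ⟨τ, hτ⟩ := h
  refine ⟨τ, fun k k' hk => ⟨fun h => (hτ k k' hk).1 ?_, fun h => (hτ k k' hk).2 ?_⟩⟩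
  · funext x; exact neg_injective (congrFun h x)
  · funext x; exact neg_injective (congrFun h x)

theorem Spread.comp {m : ℕ} {e : Fin m → ℤˣ} (h : Spread e) (σ : Equiv.Perm (Fin m)) :
    Spread (e ∘ σ) := by
  obtain ⟨τ, hτ⟩ := h
  refine ⟨fun k => σ⁻¹ * τ k, fun k k' hk => ?_⟩
  have : ∀ k, (e ∘ σ) ∘ (σ⁻¹ * τ k : Equiv.Perm (Fin m)) = e ∘ τ k := by
    intro k; funext x; simp
  rw [this, this]; exact hτ k k' hk

theorem units_ne_neg_self (u : ℤˣ) : u ≠ -u := by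
  rcases Int.units_eq_one_or u with rfl | rfl <;> decide

theorem units_eq_neg_of_ne {u v : ℤˣ} (h : u ≠ v) : u = -v := by
  rcases Int.units_eq_one_or u with rfl | rfl <;> rcases Int.units_eq_one_or v with rfl | rfl <;>
    simp_all

theorem exists_notMem_of_card_lt {m : ℕ} {s : Finset (Fin m)} (h : s.card < m) : ∃ x, x ∉ s := by
  by_contra! h'
  rw [Finset.eq_univ_iff_forall.2 h', Finset.card_univ, Fintype.card_fin] at h
  exact lt_irrefl _ h

/-- A sign function with exactly one exceptional sign is spread. -/
theorem spread_of_single {m : ℕ} (hm : 3 ≤ m) {e : Fin m → ℤˣ} {i : Fin m}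
    (he : ∀ j, j ≠ i → e j = -e i) : Spread e := by
  refine ⟨fun k => Equiv.swap i k, fun k k' hk => ?_⟩
  have h1 : ∀ k, e (Equiv.swap i k k) = e i := fun k => by rw [Equiv.swap_apply_right]
  have h2 : ∀ k x, x ≠ k → e (Equiv.swap i k x) = -e i := by
    intro k x hx
    refine he _ fun h => hx ?_
    rw [Equiv.swap_apply_eq_iff, Equiv.swap_apply_left] at h
    exact h
  constructor
  · intro h
    have := congrFun h k
    simp only [Function.comp_apply, h1, h2 k' k hk] at this
    exact units_ne_neg_self _ this
  · intro h
    obtain ⟨x, hx⟩ := exists_notMem_of_card_lt (s := {k, k'})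
      (Finset.card_le_two.trans_lt (by omega : 2 < m))
    rw [Finset.mem_insert, Finset.mem_singleton, not_or] at hx
    have := congrFun h x
    simp only [Function.comp_apply, Pi.neg_apply, h2 k x hx.1, h2 k' x hx.2] at this
    exact units_ne_neg_self _ this

/-- On five or more points every nonconstant sign function is spread: exchanging a point of
sign `1` with one of sign `-1` changes only two values. -/
theorem spread_of_five_le {m : ℕ} (hm : 5 ≤ m) {e : Fin m → ℤˣ} {i j : Fin m} (hij : e i ≠ e j) :
    Spread e := by
  set F : Fin m → Finset (Fin m) := fun k =>
    if k = i then ∅ else if e k = e i then {k, j} else {i, k} with hF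
  set τ : Fin m → Equiv.Perm (Fin m) := fun k =>
    if k = i then 1 else if e k = e i then Equiv.swap k j else Equiv.swap i k with hτ
  have hsw : ∀ a b : Fin m, e a ≠ e b → ∀ x, e (Equiv.swap a b x) =
      if x ∈ ({a, b} : Finset (Fin m)) then -e x else e x := by
    intro a b hab x
    simp only [Equiv.swap_apply_def, Finset.mem_insert, Finset.mem_singleton]
    by_cases h1 : x = a
    · subst h1; simp [units_eq_neg_of_ne hab]
    · by_cases h2 : x = b
      · subst h2; simp [h1, units_eq_neg_of_ne hab]
      · simp [h1, h2]
  have hval : ∀ k x, e (τ k x) = if x ∈ F k then -e x else e x := by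
    intro k x
    by_cases h1 : k = i
    · simp [hF, hτ, h1]
    by_cases h2 : e k = e i
    · have h3 := hsw k j (h2 ▸ hij) x
      simpa only [hF, hτ, h1, h2, if_true, if_false] using h3
    · have h3 := hsw i k (Ne.symm h2) x
      simpa only [hF, hτ, h1, h2, if_true, if_false] using h3
  have hcard : ∀ k, (F k).card ≤ 2 := by
    intro k; simp only [hF]; split_ifs
    · simp
    · exact Finset.card_le_two
    · exact Finset.card_le_two
  refine ⟨τ, fun k k' hk => ⟨fun h => ?_, fun h => ?_⟩⟩
  · obtain ⟨x, hx⟩ : ∃ x, ¬ (x ∈ F k ↔ x ∈ F k') := by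
      have hij' : i ≠ j := fun h => hij (congrArg e h)
      by_cases h1 : k = i
      · refine ⟨k', ?_⟩
        have h2 : k' ≠ i := fun h => hk (h1.trans h.symm)
        simp only [hF, h1, h2, if_true, if_false]
        split_ifs <;> simp
      by_cases h2 : k' = i
      · refine ⟨k, ?_⟩
        simp only [hF, h1, h2, if_true, if_false]
        split_ifs <;> simp
      by_cases h3 : e k = e i
      · have h3' : k ≠ j := fun h => hij (by rw [← h3, h])
        by_cases h4 : e k' = e i
        · refine ⟨k, ?_⟩
          simp [hF, h1, h2, h3, h4, hk, h3']
        · refine ⟨i, ?_⟩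
          simp [hF, h1, h2, h3, h4, Ne.symm h1, hij']
      · by_cases h4 : e k' = e i
        · refine ⟨i, ?_⟩
          simp [hF, h1, h2, h3, h4, Ne.symm h2, hij']
        · refine ⟨k, ?_⟩
          simp [hF, h1, h2, h3, h4, hk]
    have := congrFun h x
    simp only [Function.comp_apply, hval] at this
    split_ifs at this with h1 h2 h2
    · exact hx (iff_of_true h1 h2)
    · exact units_ne_neg_self _ this.symm
    · exact units_ne_neg_self _ this
    · exact hx (iff_of_false h1 h2)
  · obtain ⟨x, hx⟩ := exists_notMem_of_card_lt (s := F k ∪ F k') (by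
      have := Finset.card_union_le (F k) (F k')
      have := hcard k
      have := hcard k'
      omega)
    rw [Finset.mem_union, not_or] at hx
    have := congrFun h x
    simp only [Function.comp_apply, Pi.neg_apply, hval, hx.1, hx.2, if_false] at this
    exact units_ne_neg_self _ this

theorem spread_of_ne {m : ℕ} (hm : 3 ≤ m) (hm4 : m ≠ 4) {e : Fin m → ℤˣ} {i j : Fin m}
    (hij : e i ≠ e j) : Spread e := by
  rcases Nat.lt_or_ge m 5 with h | h
  · obtain rfl : m = 3 := by omega
    have key : ∀ e : Fin 3 → ℤˣ, ∀ i j, e i ≠ e j → ∃ i, ∀ j, j ≠ i → e j = -e i := by decide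
    obtain ⟨i, hi⟩ := key e i j hij
    exact spread_of_single le_rfl hi
  · exact spread_of_five_le h hij

theorem spread_of_prod {e : Fin 4 → ℤˣ} (he : e 0 * e 1 * (e 2 * e 3) = -1) : Spread e := by
  have key : ∀ e : Fin 4 → ℤˣ, e 0 * e 1 * (e 2 * e 3) = -1 → ∃ i, ∀ j, j ≠ i → e j = -e i := by
    decide
  obtain ⟨i, hi⟩ := key e he
  exact spread_of_single (by norm_num) hi

end SignFunctions

/-! ### Representations of small dimension -/

section LowDimension

open Matrix

variable {p q : ℕ}

/-- Joint eigenvectors that are pairwise separated by an eigenvalue are linearly independent. -/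
theorem linearIndependent_of_separated {α V : Type*} [AddCommGroup V] [Module ℝ V] (u : α → V)
    (hu : ∀ a, u a ≠ 0)
    (hsep : ∀ a b, a ≠ b → ∃ (T : V →ₗ[ℝ] V) (c : α → ℝ), (∀ x, T (u x) = c x • u x) ∧ c a ≠ c b) :
    LinearIndependent ℝ u := by
  classical
  -- a product of operators `T - c b` kills the vectors of index `b ∈ B` and rescales `u a`
  have key : ∀ (a : α) (B : Finset α), a ∉ B → ∃ (T : V →ₗ[ℝ] V) (c : α → ℝ),
      (∀ x, T (u x) = c x • u x) ∧ c a ≠ 0 ∧ ∀ b ∈ B, c b = 0 := by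
    intro a B
    induction B using Finset.induction_on with
    | empty => exact fun _ => ⟨LinearMap.id, fun _ => 1, by simp, by simp, by simp⟩
    | insert b B hb ih =>
      intro ha
      rw [Finset.mem_insert, not_or] at ha
      obtain ⟨T, c, hT, hca, hcB⟩ := ih ha.2
      obtain ⟨S, e, hS, hab⟩ := hsep a b ha.1
      refine ⟨(S - e b • LinearMap.id) ∘ₗ T, fun x => c x * (e x - e b), ?_, ?_, ?_⟩
      · intro x
        simp only [LinearMap.comp_apply, hT, map_smul, LinearMap.sub_apply, LinearMap.smul_apply,
          LinearMap.id_apply, hS]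
        module
      · exact mul_ne_zero hca (sub_ne_zero.2 hab)
      · intro x hx
        rcases Finset.mem_insert.1 hx with rfl | hx
        · simp
        · simp [hcB x hx]
  rw [linearIndependent_iff']
  intro s g hg a ha
  obtain ⟨T, c, hT, hca, hcB⟩ := key a (s.erase a) (Finset.notMem_erase a s)
  have h := congrArg T hg
  rw [map_sum, map_zero, Finset.sum_eq_single_of_mem a ha] at h
  · rw [map_smul, hT, smul_smul] at h
    exact (mul_eq_zero.1 ((smul_eq_zero.1 h).resolve_right (hu a))).resolve_right hca
  · intro b hb hba
    rw [map_smul, hT, hcB b (Finset.mem_erase.2 ⟨hba, hb⟩), zero_smul, smul_zero]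

theorem halfTurn_comm {k l : Fin p ⊕ Fin q} (hkl : k ≠ l) (hs : sgn p q k = sgn p q l) :
    halfTurn k l = halfTurn l k := by
  apply mat_injective
  rw [mat_halfTurn hkl hs, mat_halfTurn hkl.symm hs.symm]
  congr 1; funext i; simp only [turnSign, or_comm]

theorem eq_zero_of_eq_neg {V : Type*} [AddCommGroup V] [Module ℝ V] {v : V} (h : v = -v) :
    v = 0 := by
  have h2 : (2 : ℝ) • v = 0 := by rw [two_smul]; exact add_eq_zero_iff_eq_neg.2 h
  exact (smul_eq_zero.1 h2).resolve_left two_ne_zero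

section Representation

variable {V : Type*} [AddCommGroup V] [Module ℝ V] (ρ : G p q →* Module.End ℝ V)

/-- `v` is a joint eigenvector of the half turns inside the two blocks, where the half turn in the
plane of `k` and `l` has the eigenvalue `e k * e l`. -/
def HasSigns (e : Fin p ⊕ Fin q → ℤˣ) (v : V) : Prop :=
  ∀ k l, k ≠ l → sgn p q k = sgn p q l → ρ (halfTurn k l) v = (((e k * e l : ℤˣ) : ℤ) : ℝ) • v

/-- The sign function `e` belongs to some joint eigenvector. -/
def Occurs (e : Fin p ⊕ Fin q → ℤˣ) : Prop := ∃ v, v ≠ 0 ∧ HasSigns ρ e v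

theorem rho_injective (g : G p q) : Function.Injective (ρ g) := by
  refine Function.LeftInverse.injective (g := ρ g⁻¹) fun v => ?_
  rw [← Module.End.mul_apply, ← map_mul, inv_mul_cancel, map_one, Module.End.one_apply]

variable {ρ}

theorem Occurs.comp_swap {e : Fin p ⊕ Fin q → ℤˣ} (h : Occurs ρ e) {k l : Fin p ⊕ Fin q}
    (hkl : k ≠ l) (hs : sgn p q k = sgn p q l) : Occurs ρ (e ∘ Equiv.swap k l) := by
  obtain ⟨v, hv, hev⟩ := h
  refine ⟨ρ (quarterTurn k l) v,
    fun h => hv (rho_injective ρ (quarterTurn k l) (h.trans (map_zero _).symm)),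
    fun i j hij hs' => ?_⟩
  have hsi := sgn_swap (p := p) (q := q) hs
  have hij' : Equiv.swap k l i ≠ Equiv.swap k l j := (Equiv.swap k l).injective.ne hij
  have hs'' : sgn p q (Equiv.swap k l i) = sgn p q (Equiv.swap k l j) := by rw [hsi, hsi, hs']
  have hcomm := quarterTurn_mul_halfTurn hkl hs hij' hs''
  rw [Equiv.swap_apply_self, Equiv.swap_apply_self] at hcomm
  rw [← Module.End.mul_apply, ← map_mul, ← hcomm, map_mul, Module.End.mul_apply,
    hev _ _ hij' hs'', map_smul]
  rfl

theorem Occurs.comp_left {e : Fin p ⊕ Fin q → ℤˣ} (h : Occurs ρ e) (σ : Equiv.Perm (Fin p)) :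
    Occurs ρ (e ∘ Equiv.sumCongr σ (1 : Equiv.Perm (Fin q))) := by
  induction σ using Equiv.Perm.swap_induction_on generalizing e with
  | one => convert h; funext x; rcases x with x | x <;> simp
  | swap_mul f x y hxy ih =>
    have h1 := ih (h.comp_swap (k := Sum.inl x) (l := Sum.inl y) (by simpa using hxy) rfl)
    convert h1 using 1
    funext z
    rcases z with z | z
    · simp [Sum.inl_injective.swap_apply]
    · simp [Equiv.swap_apply_def]

theorem Occurs.comp_right {e : Fin p ⊕ Fin q → ℤˣ} (h : Occurs ρ e) (σ : Equiv.Perm (Fin q)) :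
    Occurs ρ (e ∘ Equiv.sumCongr (1 : Equiv.Perm (Fin p)) σ) := by
  induction σ using Equiv.Perm.swap_induction_on generalizing e with
  | one => convert h; funext x; rcases x with x | x <;> simp
  | swap_mul f x y hxy ih =>
    have h1 := ih (h.comp_swap (k := Sum.inr x) (l := Sum.inr y) (by simpa using hxy) rfl)
    convert h1 using 1
    funext z
    rcases z with z | z
    · simp [Equiv.swap_apply_def]
    · simp [Sum.inr_injective.swap_apply]

/-- Two sign functions define different characters of the group of half turns. -/
def Separated (e e' : Fin p ⊕ Fin q → ℤˣ) : Prop :=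
  ∃ k l, k ≠ l ∧ sgn p q k = sgn p q l ∧ e k * e l ≠ e' k * e' l

theorem Separated.symm {e e' : Fin p ⊕ Fin q → ℤˣ} (h : Separated e e') : Separated e' e := by
  obtain ⟨k, l, h1, h2, h3⟩ := h
  exact ⟨k, l, h1, h2, h3.symm⟩

theorem separated_of_block {m : ℕ} (hm : 0 < m) {f : Fin m → Fin p ⊕ Fin q}
    (hf : Function.Injective f) (hs : ∀ i j, sgn p q (f i) = sgn p q (f j))
    {e e' : Fin p ⊕ Fin q → ℤˣ} (h1 : e ∘ f ≠ e' ∘ f) (h2 : e ∘ f ≠ -(e' ∘ f)) :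
    Separated e e' := by
  by_contra hcon
  have h : ∀ i, e (f ⟨0, hm⟩) * e (f i) = e' (f ⟨0, hm⟩) * e' (f i) := by
    intro i
    rcases eq_or_ne ⟨0, hm⟩ i with rfl | hi
    · rw [Int.units_mul_self, Int.units_mul_self]
    · by_contra h
      exact hcon ⟨_, _, hf.ne hi, hs _ _, h⟩
  rcases eq_or_ne (e (f ⟨0, hm⟩)) (e' (f ⟨0, hm⟩)) with h0 | h0
  · refine h1 (funext fun i => ?_)
    have := h i
    rw [h0] at this
    exact mul_left_cancel this
  · refine h2 (funext fun i => ?_)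
    have := h i
    rw [units_eq_neg_of_ne h0, neg_mul, ← mul_neg] at this
    exact neg_eq_iff_eq_neg.1 (mul_left_cancel (by rwa [mul_neg] at this ⊢))

theorem card_le_of_separated [FiniteDimensional ℝ V] {α : Type*} [Fintype α]
    {e : α → Fin p ⊕ Fin q → ℤˣ} (he : ∀ a, Occurs ρ (e a))
    (hsep : ∀ a b, a ≠ b → Separated (e a) (e b)) : Fintype.card α ≤ Module.finrank ℝ V := by
  choose u hu0 hu using he
  refine (linearIndependent_of_separated u hu0 fun a b hab => ?_).fintype_card_le_finrank
  obtain ⟨k, l, hkl, hs, hne⟩ := hsep a b hab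
  refine ⟨ρ (halfTurn k l), fun x => (((e x k * e x l : ℤˣ) : ℤ) : ℝ), fun x => hu x k l hkl hs, ?_⟩
  exact fun h => hne (Units.ext (Int.cast_injective (α := ℝ) h))

/-- Commuting involutions have a joint eigenvector in every nonzero subspace that they preserve. -/
theorem exists_joint_eigenvector {β : Type*} (S : β → V →ₗ[ℝ] V) (hS : ∀ b v, S b (S b v) = v)
    (hcomm : ∀ b c v, S b (S c v) = S c (S b v)) (W : Submodule ℝ V)
    (hW : ∀ b, ∀ v ∈ W, S b v ∈ W) (hne : W ≠ ⊥) (B : Finset β) :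
    ∃ v ∈ W, v ≠ 0 ∧ ∀ b ∈ B, S b v = v ∨ S b v = -v := by
  classical
  induction B using Finset.induction_on with
  | empty =>
    obtain ⟨v, hv, h0⟩ := W.exists_mem_ne_zero_of_ne_bot hne
    exact ⟨v, hv, h0, by simp⟩
  | insert b B _ ih =>
    obtain ⟨v, hv, h0, hB⟩ := ih
    by_cases h : v + S b v = 0
    · refine ⟨v, hv, h0, fun c hc => ?_⟩
      rcases Finset.mem_insert.1 hc with rfl | hc
      · exact Or.inr (eq_neg_of_add_eq_zero_right h)
      · exact hB c hc
    · refine ⟨v + S b v, W.add_mem hv (hW b v hv), h, fun c hc => ?_⟩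
      rcases Finset.mem_insert.1 hc with rfl | hc
      · left; rw [map_add, hS, add_comm]
      · rw [map_add, hcomm c b]
        rcases hB c hc with h | h
        · left; rw [h]
        · right; rw [h, map_neg, neg_add]

/-- If `d` commutes with the half turns, then a `-1`-eigenvector of `d` can be taken to be a joint
eigenvector of all of them. -/
theorem exists_hasSigns (hp : 3 ≤ p) (hq : 3 ≤ q) {d : G p q} (hd : d * d = 1) (hρ : ρ d ≠ 1)
    (hcomm : ∀ k l, k ≠ l → sgn p q k = sgn p q l → d * halfTurn k l = halfTurn k l * d) :
    ∃ e v, v ≠ 0 ∧ HasSigns ρ e v ∧ ρ d v = -v := by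
  have hdd : ∀ v, ρ d (ρ d v) = v := fun v => by
    rw [← Module.End.mul_apply, ← map_mul, hd, map_one, Module.End.one_apply]
  set W : Submodule ℝ V := LinearMap.ker (ρ d + 1) with hW
  have hmem : ∀ v, v ∈ W ↔ ρ d v = -v := by
    intro v
    rw [hW, LinearMap.mem_ker, LinearMap.add_apply, Module.End.one_apply, add_eq_zero_iff_eq_neg]
  have hne : W ≠ ⊥ := by
    intro h
    refine hρ (LinearMap.ext fun v => ?_)
    have h1 : v - ρ d v ∈ W := by rw [hmem, map_sub, hdd, neg_sub]
    rw [h, Submodule.mem_bot, sub_eq_zero] at h1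
    exact h1.symm
  set β := {z : (Fin p ⊕ Fin q) × (Fin p ⊕ Fin q) // z.1 ≠ z.2 ∧ sgn p q z.1 = sgn p q z.2}
  obtain ⟨v, hvW, hv0, hv⟩ := exists_joint_eigenvector (fun b : β => ρ (halfTurn b.1.1 b.1.2))
    (fun b v => by
      rw [← Module.End.mul_apply, ← map_mul, halfTurn_mul_self b.2.1 b.2.2, map_one,
        Module.End.one_apply])
    (fun b c v => by
      rw [← Module.End.mul_apply, ← map_mul, halfTurn_mul_halfTurn_comm b.2.1 b.2.2 c.2.1 c.2.2,
        map_mul, Module.End.mul_apply])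
    W (fun b v hv => by
      rw [hmem] at *
      rw [← Module.End.mul_apply, ← map_mul, hcomm _ _ b.2.1 b.2.2, map_mul, Module.End.mul_apply,
        hv, map_neg]) hne Finset.univ
  have hv' : ∀ k l, ∃ u : ℤˣ, k ≠ l → sgn p q k = sgn p q l →
      ρ (halfTurn k l) v = ((u : ℤ) : ℝ) • v := by
    intro k l
    by_cases h : k ≠ l ∧ sgn p q k = sgn p q l
    · rcases hv ⟨(k, l), h⟩ (Finset.mem_univ _) with h1 | h1
      · exact ⟨1, fun _ _ => by simpa using h1⟩
      · exact ⟨-1, fun _ _ => by simpa using h1⟩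
    · exact ⟨1, fun h1 h2 => absurd ⟨h1, h2⟩ h⟩
  choose c hc using hv'
  -- the sign of an index is read off the half turn that joins it to the first index of its block
  set b : Fin p ⊕ Fin q → Fin p ⊕ Fin q :=
    Sum.elim (fun _ => Sum.inl ⟨0, by omega⟩) (fun _ => Sum.inr ⟨0, by omega⟩) with hb
  have hbs : ∀ k, sgn p q (b k) = sgn p q k := by
    intro k; rcases k with k | k <;> rfl
  have hbb : ∀ k l, sgn p q k = sgn p q l → b k = b l := by
    intro k l h
    rcases k with k | k <;> rcases l with l | l
    · rfl
    · norm_num [sgn] at h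
    · norm_num [sgn] at h
    · rfl
  refine ⟨fun k => if b k = k then 1 else c (b k) k, v, hv0, fun k l hkl hs => ?_, (hmem v).1 hvW⟩
  by_cases h1 : b k = k
  · have h2 : b l ≠ l := fun h => hkl (by rw [← h1, ← h, hbb k l hs])
    have h3 : b l = k := by rw [← hbb k l hs, h1]
    have h4 : k ≠ l := hkl
    simp only [h1, h3, h4, if_true, if_false, one_mul]
    exact hc k l hkl hs
  · by_cases h2 : b l = l
    · have h3 : b k = l := by rw [hbb k l hs, h2]
      simp only [h2, h3, hkl.symm, if_true, if_false, mul_one]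
      rw [halfTurn_comm hkl hs]
      exact hc l k hkl.symm hs.symm
    · have h5 := hbb k l hs
      simp only [h1, h2, if_false]
      rw [← halfTurn_mul_halfTurn (Ne.symm h1) (h5 ▸ h2) hkl (hbs k).symm ((hbs k).trans hs),
        map_mul, Module.End.mul_apply, ← h5, hc (b k) l (h5 ▸ h2) ((hbs k).trans hs), map_smul,
        halfTurn_comm (Ne.symm h1) (hbs k).symm, hc (b k) k h1 (hbs k), smul_smul]
      push_cast
      rw [mul_comm]

/-- If `ρ` is nontrivial, then each block carries an occurring sign function that is spread.
In a block of four indices this uses that `-1` of the block acts nontrivially. -/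
theorem exists_occurs_spread (hp : 3 ≤ p) (hq : 3 ≤ q) (hρ : ρ ≠ 1) {m : ℕ} (hm : 3 ≤ m)
    {f : Fin m → Fin p ⊕ Fin q} (hf : Function.Injective f)
    (hs : ∀ i j, sgn p q (f i) = sgn p q (f j)) {o : Fin p ⊕ Fin q} (ho : ∀ i, f i ≠ o) :
    ∃ e, Occurs ρ e ∧ Spread (e ∘ f) := by
  have hker : ∀ d ∈ ρ.ker, ∀ δ : Fin p ⊕ Fin q → ℝ, mat d = diagonal δ →
      (∀ i, δ i * δ i = 1) → ∀ i j, δ i ≠ δ j → False := by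
    intro d hd δ hδ hδ' i j hij
    have := eq_top_of_diagonal_mem ρ.ker hd hδ hδ' hij
    refine hρ (MonoidHom.ext fun g => ?_)
    exact MonoidHom.mem_ker.1 (this ▸ Subgroup.mem_top g)
  by_cases hm4 : m = 4
  · subst hm4
    have hn : ∀ i j, i ≠ j → f i ≠ f j := fun i j h => hf.ne h
    have h01 := hn 0 1 (by decide)
    have h23 := hn 2 3 (by decide)
    set d := halfTurn (f 0) (f 1) * halfTurn (f 2) (f 3) with hd
    have hmat : mat d = diagonal fun i => turnSign (f 0) (f 1) i * turnSign (f 2) (f 3) i := by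
      rw [hd, mat_mul, mat_halfTurn h01 (hs _ _), mat_halfTurn h23 (hs _ _), diagonal_mul_diagonal]
    have hsq : ∀ i, turnSign (f 0) (f 1) i * turnSign (f 2) (f 3) i *
        (turnSign (f 0) (f 1) i * turnSign (f 2) (f 3) i) = 1 := by
      intro i; rw [mul_mul_mul_comm, turnSign_mul_self, turnSign_mul_self, one_mul]
    have hd1 : ρ d ≠ 1 := by
      intro h
      refine hker d (MonoidHom.mem_ker.2 h) _ hmat hsq (f 0) o ?_
      simp [turnSign, hn 0 2 (by decide), hn 0 3 (by decide), (ho _).symm]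
      norm_num
    have hdd : d * d = 1 := by
      apply mat_injective
      rw [mat_mul, hmat, diagonal_mul_diagonal, mat_one, ← diagonal_one]
      congr 1; funext i; exact hsq i
    obtain ⟨e, v, hv0, hv, hdv⟩ := exists_hasSigns hp hq hdd hd1 (fun k l hkl hs' => by
      rw [hd, mul_assoc, halfTurn_mul_halfTurn_comm h23 (hs _ _) hkl hs', ← mul_assoc,
        halfTurn_mul_halfTurn_comm h01 (hs _ _) hkl hs', mul_assoc])
    refine ⟨e, ⟨v, hv0, hv⟩, spread_of_prod ?_⟩
    rw [hd, map_mul, Module.End.mul_apply, hv _ _ h23 (hs _ _), map_smul, hv _ _ h01 (hs _ _),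
      smul_smul] at hdv
    rcases Int.units_eq_one_or (e (f 0) * e (f 1) * (e (f 2) * e (f 3))) with h | h
    · exfalso
      rw [mul_comm] at h
      rw [← Int.cast_mul, ← Units.val_mul, h] at hdv
      simp only [Units.val_one, Int.cast_one, one_smul] at hdv
      exact hv0 (eq_zero_of_eq_neg hdv)
    · exact h
  · set i0 : Fin m := ⟨0, by omega⟩
    set i1 : Fin m := ⟨1, by omega⟩
    have h01 : f i0 ≠ f i1 := hf.ne (by simp [i0, i1])
    have hd1 : ρ (halfTurn (f i0) (f i1)) ≠ 1 := by
      intro h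
      refine hker _ (MonoidHom.mem_ker.2 h) _ (mat_halfTurn h01 (hs _ _)) (turnSign_mul_self _ _)
        (f i0) o ?_
      simp [turnSign, (ho _).symm]
      norm_num
    obtain ⟨e, v, hv0, hv, hdv⟩ := exists_hasSigns hp hq (halfTurn_mul_self h01 (hs _ _)) hd1
      (fun k l hkl hs' => halfTurn_mul_halfTurn_comm h01 (hs _ _) hkl hs')
    refine ⟨e, ⟨v, hv0, hv⟩, spread_of_ne hm hm4 (i := i0) (j := i1) fun h => ?_⟩
    have h' : e (f i0) = e (f i1) := h
    rw [hv _ _ h01 (hs _ _), h', Int.units_mul_self] at hdv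
    simp only [Units.val_one, Int.cast_one, one_smul] at hdv
    exact hv0 (eq_zero_of_eq_neg hdv)

/-- Every representation of `SO°(p,q)` of dimension less than `p + q` is trivial. -/
theorem eq_one_of_finrank_lt [FiniteDimensional ℝ V] (hp : 3 ≤ p) (hq : 3 ≤ q)
    (hV : Module.finrank ℝ V < p + q) : ρ = 1 := by
  by_contra hρ
  have hl : Function.Injective (Sum.inl : Fin p → Fin p ⊕ Fin q) := Sum.inl_injective
  have hr : Function.Injective (Sum.inr : Fin q → Fin p ⊕ Fin q) := Sum.inr_injective
  have hsl : ∀ i j : Fin p, sgn p q (Sum.inl i) = sgn p q (Sum.inl j) := fun _ _ => rfl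
  have hsr : ∀ i j : Fin q, sgn p q (Sum.inr i) = sgn p q (Sum.inr j) := fun _ _ => rfl
  obtain ⟨e, heo, hes⟩ := exists_occurs_spread hp hq hρ hp hl hsl (o := Sum.inr ⟨0, by omega⟩)
    (by simp)
  obtain ⟨e', heo', hes'⟩ := exists_occurs_spread hp hq hρ hq hr hsr (o := Sum.inl ⟨0, by omega⟩)
    (by simp)
  by_cases hboth : ∃ e, Occurs ρ e ∧ Spread (e ∘ (Sum.inl : Fin p → Fin p ⊕ Fin q)) ∧
      Spread (e ∘ (Sum.inr : Fin q → Fin p ⊕ Fin q))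
  · obtain ⟨e, he, ⟨τ, hτ⟩, τ', hτ'⟩ := hboth
    have h := card_le_of_separated (α := Fin p × Fin q)
      (fun a => (he.comp_left (τ a.1)).comp_right (τ' a.2)) (fun a b hab => by
        by_cases h1 : a.1 = b.1
        · have h2 : a.2 ≠ b.2 := fun h => hab (Prod.ext h1 h)
          exact separated_of_block (by omega) hr hsr (hτ' _ _ h2).1 (hτ' _ _ h2).2
        · exact separated_of_block (by omega) hl hsl (hτ _ _ h1).1 (hτ _ _ h1).2)
    rw [Fintype.card_prod, Fintype.card_fin, Fintype.card_fin] at h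
    nlinarith
  · obtain ⟨τ, hτ⟩ := id hes
    obtain ⟨τ', hτ'⟩ := id hes'
    -- a coincidence between the two families would be spread on both blocks
    have hmix : ∀ k l, Separated (e ∘ Equiv.sumCongr (τ k) (1 : Equiv.Perm (Fin q)))
        (e' ∘ Equiv.sumCongr (1 : Equiv.Perm (Fin p)) (τ' l)) := by
      intro k l
      have hk : Spread ((e ∘ (Sum.inl : Fin p → Fin p ⊕ Fin q)) ∘ τ k) := hes.comp _
      refine separated_of_block (by omega) hl hsl (fun h => hboth ⟨e', heo', ?_, hes'⟩)
        (fun h => hboth ⟨e', heo', ?_, hes'⟩)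
      · have h' : (e ∘ (Sum.inl : Fin p → Fin p ⊕ Fin q)) ∘ τ k =
            e' ∘ (Sum.inl : Fin p → Fin p ⊕ Fin q) := h
        rwa [h'] at hk
      · have h' : (e ∘ (Sum.inl : Fin p → Fin p ⊕ Fin q)) ∘ τ k =
            -(e' ∘ (Sum.inl : Fin p → Fin p ⊕ Fin q)) := h
        rw [h'] at hk
        simpa using hk.neg
    have h := card_le_of_separated (ρ := ρ) (α := Fin p ⊕ Fin q)
      (e := Sum.elim (fun k => e ∘ Equiv.sumCongr (τ k) (1 : Equiv.Perm (Fin q)))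
        (fun l => e' ∘ Equiv.sumCongr (1 : Equiv.Perm (Fin p)) (τ' l)))
      (by
        rintro (k | l)
        · exact heo.comp_left _
        · exact heo'.comp_right _)
      (by
        rintro (k | l) (k' | l') hab
        · have hk : k ≠ k' := fun h => hab (congrArg _ h)
          exact separated_of_block (by omega) hl hsl (hτ _ _ hk).1 (hτ _ _ hk).2
        · exact hmix k l'
        · exact (hmix k' l).symm
        · have hk : l ≠ l' := fun h => hab (congrArg _ h)
          exact separated_of_block (by omega) hr hsr (hτ' _ _ hk).1 (hτ' _ _ hk).2)
    rw [Fintype.card_sum, Fintype.card_fin, Fintype.card_fin] at h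
    omega

end Representation

end LowDimension

/-! ### Analytic self-maps of a manifold near a fixed point -/

section AnalyticMaps

section Charts

variable {n : ℕ} {M : Type*} [TopologicalSpace M] [ChartedSpace (EuclideanSpace ℝ (Fin n)) M]

/-- The map `f` read in the preferred chart at `x₀`, on the source and on the target. The value at
`y` is meaningful only if `y` lies in the target of the chart and its image under `f` stays in the
source. -/
def inChart (x₀ : M) (f : M → M) (y : EuclideanSpace ℝ (Fin n)) : EuclideanSpace ℝ (Fin n) :=
  extChartAt (𝓡 n) x₀ (f ((extChartAt (𝓡 n) x₀).symm y))

theorem eventually_chart_symm_mem {x₀ : M} {U : Set M} (hU : U ∈ 𝓝 x₀) :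
    ∀ᶠ y in 𝓝 (extChartAt (𝓡 n) x₀ x₀), (extChartAt (𝓡 n) x₀).symm y ∈ U := by
  have h := (continuousAt_extChartAt_symm (I := 𝓡 n) x₀)
  refine h.eventually ?_
  rw [extChartAt_to_inv]; exact hU

theorem chart_inChart {x₀ : M} {f : M → M} {x : M} (hx : x ∈ (extChartAt (𝓡 n) x₀).source) :
    inChart x₀ f (extChartAt (𝓡 n) x₀ x) = extChartAt (𝓡 n) x₀ (f x) := by
  rw [inChart, (extChartAt (𝓡 n) x₀).left_inv hx]

theorem analyticAt_inChart [IsManifold (𝓡 n) ω M] {x₀ : M} {f : M → M}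
    (hf : ContMDiffAt (𝓡 n) (𝓡 n) ω f x₀) (hx : f x₀ ∈ (extChartAt (𝓡 n) x₀).source) :
    AnalyticAt ℝ (inChart x₀ f) (extChartAt (𝓡 n) x₀ x₀) := by
  have h1 : ContMDiffAt 𝓘(ℝ, EuclideanSpace ℝ (Fin n)) (𝓡 n) ω (extChartAt (𝓡 n) x₀).symm
      (extChartAt (𝓡 n) x₀ x₀) :=
    (contMDiffOn_extChartAt_symm x₀).contMDiffAt (extChartAt_target_mem_nhds x₀)
  have h2 : ContMDiffAt (𝓡 n) 𝓘(ℝ, EuclideanSpace ℝ (Fin n)) ω (extChartAt (𝓡 n) x₀) (f x₀) :=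
    contMDiffAt_extChartAt' (by rwa [extChartAt_source] at hx)
  have e : (extChartAt (𝓡 n) x₀).symm (extChartAt (𝓡 n) x₀ x₀) = x₀ := extChartAt_to_inv x₀
  have h3 : ContMDiffAt 𝓘(ℝ, EuclideanSpace ℝ (Fin n)) (𝓡 n) ω
      (fun y => f ((extChartAt (𝓡 n) x₀).symm y)) (extChartAt (𝓡 n) x₀ x₀) :=
    ContMDiffAt.comp (g := f) _ (by rwa [e]) h1
  have h4 : ContMDiffAt 𝓘(ℝ, EuclideanSpace ℝ (Fin n)) 𝓘(ℝ, EuclideanSpace ℝ (Fin n)) ω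
      (inChart x₀ f) (extChartAt (𝓡 n) x₀ x₀) :=
    ContMDiffAt.comp (g := extChartAt (𝓡 n) x₀) _ (by rwa [e]) h3
  exact h4.contDiffAt.analyticAt

/-- If `f` fixes `x₀` and is the identity in the chart at `x₀`, it is the identity near `x₀`. -/
theorem eventually_eq_self_of_inChart {x₀ : M} {f : M → M} (hf : ContinuousAt f x₀)
    (hx : f x₀ = x₀) (h : ∀ᶠ y in 𝓝 (extChartAt (𝓡 n) x₀ x₀), inChart x₀ f y = y) :
    ∀ᶠ x in 𝓝 x₀, f x = x := by
  have hs : (extChartAt (𝓡 n) x₀).source ∈ 𝓝 x₀ := extChartAt_source_mem_nhds x₀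
  have h1 := (continuousAt_extChartAt (I := 𝓡 n) x₀).eventually h
  have h2 : ∀ᶠ x in 𝓝 x₀, f x ∈ (extChartAt (𝓡 n) x₀).source := hf.eventually (by rwa [hx])
  filter_upwards [h1, h2, hs] with x hx1 hx2 hx3
  rw [chart_inChart hx3] at hx1
  exact (extChartAt (𝓡 n) x₀).injOn hx2 hx3 hx1

/-- An analytic self-map of a connected manifold that is the identity near one point is the
identity. -/
theorem eq_self_of_eventually_eq_self [T2Space M] [PreconnectedSpace M] [IsManifold (𝓡 n) ω M]
    {f : M → M} (hf : ContMDiff (𝓡 n) (𝓡 n) ω f) {x₀ : M} (h₀ : ∀ᶠ x in 𝓝 x₀, f x = x) (x : M) :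
    f x = x := by
  set U : Set M := {x | ∀ᶠ y in 𝓝 x, f y = y} with hU
  have hopen : IsOpen U := isOpen_iff_mem_nhds.2 fun x hx => eventually_eventually_nhds.2 hx
  have hclosed : IsClosed U := by
    refine isClosed_of_closure_subset fun x hx => ?_
    have hfix : f x = x := by
      have hc : IsClosed {y | f y = y} := isClosed_eq hf.continuous continuous_id
      exact closure_minimal (fun y (hy : y ∈ U) => hy.self_of_nhds) hc hx
    have han := analyticAt_inChart (hf x) (by rw [hfix]; exact mem_extChartAt_source x)
    obtain ⟨r, hr, hball⟩ := han.exists_ball_analyticOnNhd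
    -- a point of `U` whose image under the chart lies in the ball of convergence
    have hnb : (extChartAt (𝓡 n) x).source ∩ (extChartAt (𝓡 n) x) ⁻¹'
        Metric.ball (extChartAt (𝓡 n) x x) r ∈ 𝓝 x :=
      Filter.inter_mem (extChartAt_source_mem_nhds x)
        ((continuousAt_extChartAt (I := 𝓡 n) x) (Metric.ball_mem_nhds _ hr))
    obtain ⟨z, ⟨hz1, hz2⟩, hzU⟩ := mem_closure_iff_nhds.1 hx _ hnb
    have hz : ∀ᶠ y in 𝓝 (extChartAt (𝓡 n) x z), inChart x f y = y := by
      have ht : (extChartAt (𝓡 n) x).target ∈ 𝓝 (extChartAt (𝓡 n) x z) :=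
        extChartAt_target_mem_nhds' ((extChartAt (𝓡 n) x).map_source hz1)
      have hc : ContinuousAt (extChartAt (𝓡 n) x).symm (extChartAt (𝓡 n) x z) :=
        continuousAt_extChartAt_symm' hz1
      have hzU' : ∀ᶠ y in 𝓝 ((extChartAt (𝓡 n) x).symm (extChartAt (𝓡 n) x z)), f y = y := by
        rw [(extChartAt (𝓡 n) x).left_inv hz1]; exact hzU
      filter_upwards [ht, hc.eventually hzU'] with y hy1 hy2
      rw [inChart, hy2, (extChartAt (𝓡 n) x).right_inv hy1]
    have heq := hball.eqOn_of_preconnected_of_eventuallyEq analyticOnNhd_id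
      (convex_ball _ _).isPreconnected hz2 hz
    refine eventually_eq_self_of_inChart (n := n) hf.continuous.continuousAt hfix ?_
    filter_upwards [Metric.ball_mem_nhds _ hr] with y hy using heq hy
  have huniv : U = Set.univ := IsClopen.eq_univ ⟨hclosed, hopen⟩ ⟨x₀, h₀⟩
  have hx : x ∈ U := huniv ▸ Set.mem_univ x
  exact hx.self_of_nhds

end Charts

section Jets

variable {E : Type*} [NormedAddCommGroup E] [NormedSpace ℝ E]

/-- The leading homogeneous term of a power series as a limit. -/
theorem tendsto_leading_term {f : E → E} {P : FormalMultilinearSeries ℝ E E} {y₀ : E}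
    (hf : HasFPowerSeriesAt f P y₀) {k : ℕ} (hP : ∀ j < k, ∀ v, P j (fun _ => v) = 0)
    {u : ℝ → E} {v : E} (hu : Filter.Tendsto u (𝓝[≠] 0) (𝓝 v)) :
    Filter.Tendsto (fun t : ℝ => (t ^ k)⁻¹ • f (y₀ + t • u t)) (𝓝[≠] 0)
      (𝓝 (P k fun _ => v)) := by
  have hO := hf.isBigO_sub_partialSum_pow (k + 1)
  have ht0 : Filter.Tendsto (fun t : ℝ => t) (𝓝[≠] 0) (𝓝 0) := Filter.tendsto_id.mono_left
    nhdsWithin_le_nhds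
  have hw : Filter.Tendsto (fun t : ℝ => t • u t) (𝓝[≠] 0) (𝓝 0) := by
    simpa using ht0.smul hu
  have hO1 := hO.comp_tendsto hw
  have hpart : ∀ w, P.partialSum (k + 1) w = P k fun _ => w := by
    intro w
    rw [FormalMultilinearSeries.partialSum, Finset.sum_range_succ, Finset.sum_eq_zero, zero_add]
    intro j hj
    exact hP j (Finset.mem_range.1 hj) w
  have hO2 : (fun t : ℝ => (t ^ k)⁻¹ • (f (y₀ + t • u t) - P k fun _ => t • u t)) =O[𝓝[≠] 0]
      fun t => (t ^ k)⁻¹ • ‖t • u t‖ ^ (k + 1) := by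
    refine (Asymptotics.isBigO_refl _ _).smul ?_
    simpa only [Function.comp_def, hpart] using hO1
  have hlim : Filter.Tendsto (fun t : ℝ => (t ^ k)⁻¹ • ‖t • u t‖ ^ (k + 1)) (𝓝[≠] 0) (𝓝 0) := by
    rw [tendsto_zero_iff_norm_tendsto_zero]
    have h1 : Filter.Tendsto (fun t : ℝ => |t| * ‖u t‖ ^ (k + 1)) (𝓝[≠] 0) (𝓝 0) := by
      simpa using ht0.abs.mul (hu.norm.pow (k + 1))
    refine h1.congr' ?_
    filter_upwards [self_mem_nhdsWithin] with t ht
    have ht' : |t| ≠ 0 := abs_ne_zero.2 ht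
    rw [norm_smul, norm_inv, norm_pow, norm_pow, norm_norm, norm_smul, Real.norm_eq_abs, mul_pow,
      pow_succ |t|]
    field_simp
  have h0 := hO2.trans_tendsto hlim
  have hQ : Filter.Tendsto (fun t : ℝ => P k fun _ => u t) (𝓝[≠] 0) (𝓝 (P k fun _ => v)) :=
    ((P k).cont.tendsto _).comp (tendsto_pi_nhds.2 fun _ => hu)
  have hsum := h0.add hQ
  rw [zero_add] at hsum
  refine hsum.congr' ?_
  filter_upwards [self_mem_nhdsWithin] with t ht
  have ht' : t ^ k ≠ 0 := pow_ne_zero _ ht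
  have h2 : (P k fun _ => t • u t) = t ^ k • P k fun _ => u t := by
    have := (P k).map_smul_univ (fun _ => t) (fun _ => u t)
    simpa using this
  rw [h2, smul_sub, smul_smul, inv_mul_cancel₀ ht', one_smul, sub_add_cancel]

/-- A perfect group that acts by germs of analytic maps at a fixed point, with trivial derivative,
acts trivially: the first nontrivial homogeneous term of the power series would be additive in the
group element. -/
theorem eventually_eq_self_of_fderiv_eq_id {Γ : Type*} [Group Γ]
    (hΓ : ∀ N : Subgroup Γ, (∀ g h : Γ, g * h * g⁻¹ * h⁻¹ ∈ N) → N = ⊤)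
    {ψ : Γ → E → E} {y₀ : E} (han : ∀ g, AnalyticAt ℝ (ψ g) y₀) (hfix : ∀ g, ψ g y₀ = y₀)
    (hmul : ∀ g h, ∀ᶠ y in 𝓝 y₀, ψ (g * h) y = ψ g (ψ h y))
    (hd : ∀ g, HasFDerivAt (ψ g) (ContinuousLinearMap.id ℝ E) y₀) (g : Γ) :
    ∀ᶠ y in 𝓝 y₀, ψ g y = y := by
  set f : Γ → E → E := fun g y => ψ g y - y with hf
  have hfan : ∀ g, AnalyticAt ℝ (f g) y₀ := fun g => (han g).sub analyticAt_id
  choose P hP using hfan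
  have hf0 : ∀ g, f g y₀ = 0 := fun g => by simp [hf, hfix]
  have hfd : ∀ g, HasFDerivAt (f g) (0 : E →L[ℝ] E) y₀ := by
    intro g
    exact ((hd g).sub (hasFDerivAt_id y₀)).congr_fderiv (sub_self _)
  have hslope : ∀ g v, Filter.Tendsto (fun t : ℝ => t⁻¹ • f g (y₀ + t • v)) (𝓝[≠] 0) (𝓝 0) := by
    intro g v
    have h1 : HasDerivAt (fun t : ℝ => y₀ + t • v) v 0 := by
      simpa using ((hasDerivAt_id (0 : ℝ)).smul_const v).const_add y₀
    have h2 : HasDerivAt (fun t : ℝ => f g (y₀ + t • v)) 0 0 := by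
      have h3 : HasFDerivAt (f g) (0 : E →L[ℝ] E) (y₀ + (0 : ℝ) • v) := by simpa using hfd g
      have h5 := h3.comp_hasDerivAt (0 : ℝ) h1
      rw [zero_apply] at h5
      exact h5
    have h4 := h2.tendsto_slope_zero
    simpa [hf0] using h4
  have hzero : ∀ k, ∀ j < k, ∀ g v, P g j (fun _ => v) = 0 := by
    intro k
    induction k with
    | zero => intro j hj; omega
    | succ k ih =>
      have hadd : ∀ g h v, P (g * h) k (fun _ => v) = P g k (fun _ => v) + P h k fun _ => v := by
        intro g h v
        have hu : Filter.Tendsto (fun t : ℝ => v + t⁻¹ • f h (y₀ + t • v)) (𝓝[≠] 0) (𝓝 v) := by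
          simpa using (hslope h v).const_add v
        have h1 := tendsto_leading_term (hP g) (fun j hj => ih j hj g) hu
        have h2 := tendsto_leading_term (hP h) (fun j hj => ih j hj h)
          (tendsto_const_nhds (x := v))
        have h3 := tendsto_leading_term (hP (g * h)) (fun j hj => ih j hj (g * h))
          (tendsto_const_nhds (x := v))
        refine tendsto_nhds_unique h3 ((h1.add h2).congr' ?_)
        have hline : Filter.Tendsto (fun t : ℝ => y₀ + t • v) (𝓝[≠] 0) (𝓝 y₀) := by
          have : Continuous fun t : ℝ => y₀ + t • v := by fun_prop
          have h4 := (this.tendsto 0).mono_left (nhdsWithin_le_nhds (s := {0}ᶜ))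
          simpa using h4
        filter_upwards [hline.eventually (hmul g h), self_mem_nhdsWithin] with t ht ht0
        have ht0' : t ≠ 0 := ht0
        rw [← smul_add]
        congr 1
        have h5 : y₀ + t • (v + t⁻¹ • f h (y₀ + t • v)) = ψ h (y₀ + t • v) := by
          rw [smul_add, smul_smul, mul_inv_cancel₀ ht0', one_smul]
          simp only [hf]; abel
        rw [h5]
        simp only [hf]
        rw [ht]; abel
      have hker : ∀ g v, P g k (fun _ => v) = 0 := by
        intro g v
        have h1 : P 1 k (fun _ => v) = 0 := by
          have := hadd 1 1 v
          rw [mul_one] at this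
          exact left_eq_add.1 this
        let φ : Γ →* Multiplicative E :=
          { toFun := fun g => Multiplicative.ofAdd (P g k fun _ => v)
            map_one' := by rw [h1]; rfl
            map_mul' := fun g h => by rw [hadd, ofAdd_add] }
        have htop : φ.ker = ⊤ := hΓ _ fun a b => by
          rw [MonoidHom.mem_ker, map_mul, map_mul, map_mul, map_inv, map_inv, mul_right_comm (φ a),
            mul_inv_cancel, one_mul, mul_inv_cancel]
        have hg : g ∈ φ.ker := htop ▸ Subgroup.mem_top g
        exact hg
      intro j hj g v
      rcases Nat.lt_succ_iff_lt_or_eq.1 hj with h | rfl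
      · exact ih j h g v
      · exact hker g v
  have hsum := (hP g).eventually_hasSum_sub
  filter_upwards [hsum] with y hy
  have h1 : (fun j => P g j fun _ => y - y₀) = fun _ => 0 := by
    funext j; exact hzero (j + 1) j (Nat.lt_succ_self j) g _
  rw [h1] at hy
  exact sub_eq_zero.1 (hy.unique hasSum_zero)

end Jets

end AnalyticMaps

/-! ### Fixed points of analytic actions -/

section FixedPoints

open Matrix

section Action

variable {p q n : ℕ} {M : Type*} [TopologicalSpace M] [ChartedSpace (EuclideanSpace ℝ (Fin n)) M]
  [MulAction (G p q) M]

theorem IsAnalyticAction.contMDiff_smul (h : IsAnalyticAction p q n M) (g : G p q) :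
    ContMDiff (𝓡 n) (𝓡 n) ω (fun x : M => g • x) := by
  intro x
  obtain ⟨F, hF, hev⟩ := h g x
  have h1 : ContMDiffAt (𝓡 n) (𝓘(ℝ, Fin p ⊕ Fin q → Fin p ⊕ Fin q → ℝ).prod (𝓡 n)) ω
      (fun y : M => (entries g, y)) x := contMDiffAt_const.prodMk contMDiffAt_id
  have h2 : ContMDiffAt (𝓡 n) (𝓡 n) ω (fun y : M => F (entries g, y)) x :=
    ContMDiffAt.comp (g := F) x hF h1
  refine h2.congr_of_eventuallyEq ?_
  have hc : ContinuousAt (fun y : M => (g, y)) x := by fun_prop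
  filter_upwards [hc.eventually hev] with y hy using hy.symm

/-- A fixed point of `SO°(p,q)` on an analytic manifold of dimension less than `p + q` forces the
action to be trivial. -/
theorem smul_eq_self_of_fixed [T2Space M] [PreconnectedSpace M] [IsManifold (𝓡 n) ω M]
    (hp : 3 ≤ p) (hq : 3 ≤ q) (hn : n < p + q) (h : IsAnalyticAction p q n M) {x₀ : M}
    (hx₀ : ∀ g : G p q, g • x₀ = x₀) (g : G p q) (x : M) : g • x = x := by
  set ψ : G p q → EuclideanSpace ℝ (Fin n) → EuclideanSpace ℝ (Fin n) :=
    fun g => inChart x₀ fun x => g • x with hψ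
  set y₀ : EuclideanSpace ℝ (Fin n) := extChartAt (𝓡 n) x₀ x₀ with hy₀
  have han : ∀ g, AnalyticAt ℝ (ψ g) y₀ := fun g =>
    analyticAt_inChart (h.contMDiff_smul g x₀) (by rw [hx₀]; exact mem_extChartAt_source x₀)
  have hfix : ∀ g, ψ g y₀ = y₀ := fun g => by
    simp only [hψ, hy₀]
    rw [chart_inChart (mem_extChartAt_source x₀), hx₀]
  have hmul : ∀ g k, ∀ᶠ y in 𝓝 y₀, ψ (g * k) y = ψ g (ψ k y) := by
    intro g k
    have hU : {x : M | k • x ∈ (extChartAt (𝓡 n) x₀).source} ∈ 𝓝 x₀ := by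
      refine (h.contMDiff_smul k).continuous.continuousAt.preimage_mem_nhds ?_
      rw [hx₀]; exact extChartAt_source_mem_nhds x₀
    filter_upwards [eventually_chart_symm_mem hU] with y hy
    simp only [hψ, inChart]
    rw [(extChartAt (𝓡 n) x₀).left_inv hy, mul_smul]
  have hone : ∀ᶠ y in 𝓝 y₀, ψ 1 y = y := by
    filter_upwards [extChartAt_target_mem_nhds (I := 𝓡 n) x₀] with y hy
    simp only [hψ, inChart, one_smul]
    exact (extChartAt (𝓡 n) x₀).right_inv hy
  -- the isotropy representation
  let ρ : G p q →* Module.End ℝ (EuclideanSpace ℝ (Fin n)) :=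
    { toFun := fun g => (fderiv ℝ (ψ g) y₀ : EuclideanSpace ℝ (Fin n) →ₗ[ℝ] _)
      map_one' := by
        rw [Filter.EventuallyEq.fderiv_eq (f := id) hone, fderiv_id]; rfl
      map_mul' := fun g k => by
        rw [Filter.EventuallyEq.fderiv_eq (f := ψ g ∘ ψ k) (hmul g k),
          fderiv_comp y₀ (by rw [hfix]; exact (han g).differentiableAt) (han k).differentiableAt,
          hfix]
        rfl }
  have hρ : ρ = 1 := eq_one_of_finrank_lt hp hq (by rwa [finrank_euclideanSpace_fin])
  have hd : ∀ g, HasFDerivAt (ψ g) (ContinuousLinearMap.id ℝ _) y₀ := by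
    intro g
    have h1 : ρ g = 1 := by rw [hρ]; rfl
    have h2 : fderiv ℝ (ψ g) y₀ = ContinuousLinearMap.id ℝ _ := by
      ext1 v; exact LinearMap.congr_fun h1 v
    rw [← h2]
    exact (han g).differentiableAt.hasFDerivAt
  have hev := eventually_eq_self_of_fderiv_eq_id (eq_top_of_commutator_mem hp hq) han hfix hmul hd g
  exact eq_self_of_eventually_eq_self (n := n) (h.contMDiff_smul g)
    (eventually_eq_self_of_inChart (n := n) (h.contMDiff_smul g).continuous.continuousAt
      (hx₀ g) hev) x

theorem hasDerivAt_entries (X : so p q) :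
    HasDerivAt (fun t : ℝ => entries (expG (t • X))) (fun i j => X.1 i j) 0 := by
  open scoped Matrix.Norms.Operator in
  have h1 := hasDerivAt_exp_smul X.1 0
  rw [zero_smul, NormedSpace.exp_zero, one_mul] at h1
  refine hasDerivAt_pi.2 fun i => hasDerivAt_pi.2 fun j => ?_
  have h2 := (LinearMap.toContinuousLinearMap
    (Matrix.entryLinearMap ℝ ℝ i j)).hasFDerivAt.comp_hasDerivAt (0 : ℝ) h1
  exact h2

/-- The orbit map of `x₀`, read in the chart at `x₀`, has a derivative at `1` that depends linearly
on the tangent direction. -/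
theorem exists_orbit_deriv [IsManifold (𝓡 n) ω M] (h : IsAnalyticAction p q n M) (x₀ : M) :
    ∃ D : so p q →ₗ[ℝ] EuclideanSpace ℝ (Fin n), ∀ X, HasDerivAt
      (fun t : ℝ => extChartAt (𝓡 n) x₀ (expG (t • X) • x₀)) (D X) 0 := by
  obtain ⟨F, hF, hev⟩ := h 1 x₀
  have hF1 : F (entries (1 : G p q), x₀) = x₀ := by
    have := hev.self_of_nhds
    rwa [one_smul] at this
  have h1 : ContMDiffAt 𝓘(ℝ, Fin p ⊕ Fin q → Fin p ⊕ Fin q → ℝ)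
      (𝓘(ℝ, Fin p ⊕ Fin q → Fin p ⊕ Fin q → ℝ).prod (𝓡 n)) ω
      (fun A : Fin p ⊕ Fin q → Fin p ⊕ Fin q → ℝ => (A, x₀)) (entries (1 : G p q)) :=
    contMDiffAt_id.prodMk contMDiffAt_const
  have h2 : ContMDiffAt 𝓘(ℝ, Fin p ⊕ Fin q → Fin p ⊕ Fin q → ℝ) (𝓡 n) ω
      (fun A => F (A, x₀)) (entries (1 : G p q)) := ContMDiffAt.comp (g := F) _ hF h1
  have h3 : ContMDiffAt 𝓘(ℝ, Fin p ⊕ Fin q → Fin p ⊕ Fin q → ℝ)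
      𝓘(ℝ, EuclideanSpace ℝ (Fin n)) ω
      (fun A => extChartAt (𝓡 n) x₀ (F (A, x₀))) (entries (1 : G p q)) :=
    ContMDiffAt.comp (g := extChartAt (𝓡 n) x₀) _ (by rw [hF1]; exact contMDiffAt_extChartAt) h2
  have h4 := (h3.contDiffAt.analyticAt).differentiableAt.hasFDerivAt
  set L := fderiv ℝ (fun A => extChartAt (𝓡 n) x₀ (F (A, x₀))) (entries (1 : G p q)) with hL
  refine ⟨
    { toFun := fun X => L fun i j => X.1 i j
      map_add' := fun X Y => by rw [← map_add]; rfl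
      map_smul' := fun c X => by rw [RingHom.id_apply, ← map_smul]; rfl }, fun X => ?_⟩
  have h0 : entries (expG ((0 : ℝ) • X)) = entries (1 : G p q) := by rw [zero_smul, expG_zero]
  have h5 := (h0 ▸ h4 : HasFDerivAt _ L (entries (expG ((0 : ℝ) • X)))).comp_hasDerivAt (0 : ℝ)
    (hasDerivAt_entries X)
  refine HasDerivAt.congr_of_eventuallyEq h5 ?_
  have hc : ContinuousAt (fun t : ℝ => (expG (t • X), x₀)) 0 := by
    have := continuous_expG.comp
      (continuous_id.smul continuous_const : Continuous fun t : ℝ => t • X)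
    exact (this.prodMk continuous_const).continuousAt
  have hev' : ∀ᶠ z : G p q × M in 𝓝 (expG ((0 : ℝ) • X), x₀), F (entries z.1, z.2) = z.1 • z.2 := by
    rwa [zero_smul, expG_zero]
  filter_upwards [hc.eventually hev'] with t ht
  simp only [Function.comp_apply]
  rw [ht]

theorem tendsto_expG_smul (h : IsAnalyticAction p q n M) (x₀ : M) (X : so p q) :
    Filter.Tendsto (fun t : ℝ => expG (t • X) • x₀) (𝓝 0) (𝓝 x₀) := by
  obtain ⟨F, hF, hev⟩ := h 1 x₀
  have hF1 : F (entries (1 : G p q), x₀) = x₀ := by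
    have := hev.self_of_nhds
    rwa [one_smul] at this
  have hc : Filter.Tendsto (fun t : ℝ => (expG (t • X), x₀)) (𝓝 0) (𝓝 (1, x₀)) := by
    have h1 := continuous_expG.comp
      (continuous_id.smul continuous_const : Continuous fun t : ℝ => t • X)
    have h2 := (h1.prodMk (continuous_const (y := x₀))).tendsto 0
    simpa [expG_zero] using h2
  have hc' : Filter.Tendsto (fun z : G p q × M => F (entries z.1, z.2)) (𝓝 (1, x₀)) (𝓝 x₀) := by
    have h1 : Continuous fun z : G p q × M => (entries z.1, z.2) :=
      (continuous_mat.comp continuous_fst).prodMk continuous_snd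
    have h2 := Filter.Tendsto.comp (g := F) hF.continuousAt (h1.tendsto (1, x₀))
    rwa [hF1] at h2
  exact (hc'.congr' hev).comp hc

/-- If the orbit map has derivative zero in the direction `X`, then the one-parameter group of `X`
fixes the point. -/
theorem expG_smul_eq_of_deriv_eq_zero [IsManifold (𝓡 n) ω M] (h : IsAnalyticAction p q n M) {x₀ : M}
    {X : so p q}
    (hX : HasDerivAt (fun t : ℝ => extChartAt (𝓡 n) x₀ (expG (t • X) • x₀)) 0 0) (t : ℝ) :
    expG (t • X) • x₀ = x₀ := by
  set γ : ℝ → EuclideanSpace ℝ (Fin n) := fun t => extChartAt (𝓡 n) x₀ (expG (t • X) • x₀) with hγ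
  have hγ0 : γ 0 = extChartAt (𝓡 n) x₀ x₀ := by
    simp only [hγ, zero_smul, expG_zero, one_smul]
  have hsrc := (tendsto_expG_smul h x₀ X).eventually (extChartAt_source_mem_nhds (I := 𝓡 n) x₀)
  obtain ⟨δ, hδ, hball⟩ := Metric.eventually_nhds_iff_ball.1 hsrc
  -- by the group law the derivative vanishes at all small times
  have hd : ∀ s ∈ Metric.ball (0 : ℝ) δ, HasDerivAt γ 0 s := by
    intro s hs
    have han := analyticAt_inChart (h.contMDiff_smul (expG (s • X)) x₀) (hball s hs)
    have h1 : HasFDerivAt (inChart x₀ fun x => expG (s • X) • x)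
        (fderiv ℝ (inChart x₀ fun x => expG (s • X) • x) (extChartAt (𝓡 n) x₀ x₀)) (γ 0) := by
      rw [hγ0]; exact han.differentiableAt.hasFDerivAt
    have h2 := h1.comp_hasDerivAt (0 : ℝ) hX
    rw [map_zero] at h2
    have h3 : HasDerivAt (fun r => γ (s + r)) 0 0 := by
      refine h2.congr_of_eventuallyEq ?_
      filter_upwards [hsrc] with r hr
      simp only [Function.comp_apply, hγ]
      rw [chart_inChart hr, expG_add_smul, mul_smul]
    have h4 : HasDerivAt (fun r => γ (s + r)) 0 (s - s) := by rwa [sub_self]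
    have h5 := HasDerivAt.comp_sub_const s s h4
    simpa using h5
  have hconst : ∀ s ∈ Metric.ball (0 : ℝ) δ, γ s = γ 0 := by
    intro s hs
    refine Metric.isOpen_ball.is_const_of_deriv_eq_zero (convex_ball (0 : ℝ) δ).isPreconnected
      (fun r hr => (hd r hr).differentiableAt.differentiableWithinAt)
      (fun r hr => (hd r hr).deriv) hs (Metric.mem_ball_self hδ)
  have hfix : ∀ s ∈ Metric.ball (0 : ℝ) δ, expG (s • X) • x₀ = x₀ := by
    intro s hs
    refine (extChartAt (𝓡 n) x₀).injOn (hball s hs) (mem_extChartAt_source x₀) ?_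
    rw [← hγ0, ← hconst s hs]
  have hpow : ∀ (N : ℕ) (s : ℝ), expG (s • X) • x₀ = x₀ → expG ((N * s) • X) • x₀ = x₀ := by
    intro N s hs
    induction N with
    | zero => simp [expG_zero]
    | succ N ih =>
      rw [Nat.cast_succ, add_mul, one_mul, expG_add_smul, mul_smul, hs, ih]
  obtain ⟨N, hN⟩ := exists_nat_gt (|t| / δ)
  have hN0 : (0 : ℝ) < N := lt_of_le_of_lt (by positivity) hN
  have hsmall : t / N ∈ Metric.ball (0 : ℝ) δ := by
    rw [Metric.mem_ball, dist_zero_right, Real.norm_eq_abs, abs_div, Nat.abs_cast,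
      div_lt_iff₀ hN0]
    rwa [div_lt_iff₀ hδ, mul_comm] at hN
  have := hpow N _ (hfix _ hsmall)
  rwa [mul_div_cancel₀ _ hN0.ne'] at this

/-- A fixed point of `K` on an analytic manifold of dimension less than `pq` is fixed by
`SO°(p,q)`. -/
theorem fixed_of_K_fixed [IsManifold (𝓡 n) ω M] (hp : 3 ≤ p) (hq : 3 ≤ q) (hn : n < p * q)
    (h : IsAnalyticAction p q n M) {x₀ : M} (hx₀ : ∀ k ∈ K p q, k • x₀ = x₀) (g : G p q) :
    g • x₀ = x₀ := by
  obtain ⟨D, hD⟩ := exists_orbit_deriv h x₀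
  set T : G p q → EuclideanSpace ℝ (Fin n) →L[ℝ] EuclideanSpace ℝ (Fin n) := fun k =>
    fderiv ℝ (inChart x₀ fun x => k • x) (extChartAt (𝓡 n) x₀ x₀) with hT
  -- equivariance under `K`
  have hequiv : ∀ k ∈ K p q, ∀ X, T k (D X) = D (Ad k X) := by
    intro k hk X
    have hk1 := hx₀ k hk
    have hk2 : k⁻¹ • x₀ = x₀ := by rw [inv_smul_eq_iff, hk1]
    have han := analyticAt_inChart (h.contMDiff_smul k x₀)
      (by rw [hk1]; exact mem_extChartAt_source x₀)
    have h1 : HasFDerivAt (inChart x₀ fun x => k • x) (T k)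
        (extChartAt (𝓡 n) x₀ (expG ((0 : ℝ) • X) • x₀)) := by
      rw [zero_smul, expG_zero, one_smul]; exact han.differentiableAt.hasFDerivAt
    have h2 := h1.comp_hasDerivAt (0 : ℝ) (hD X)
    refine h2.unique ((hD (Ad k X)).congr_of_eventuallyEq ?_)
    filter_upwards [(tendsto_expG_smul h x₀ X).eventually
      (extChartAt_source_mem_nhds (I := 𝓡 n) x₀)] with t ht
    simp only [Function.comp_apply]
    rw [chart_inChart ht, ← map_smul, ← conj_expG, mul_smul, mul_smul, hk2]
  set W := LinearMap.ker D with hW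
  have hAdW : ∀ k ∈ K p q, ∀ X ∈ W, Ad k X ∈ W := by
    intro k hk X hX
    rw [hW, LinearMap.mem_ker] at *
    rw [← hequiv k hk, hX, map_zero]
  have hrot : ∀ i j, sgn p q i = sgn p q j → planeGen i j ∈ W := by
    intro i j hs
    rw [hW, LinearMap.mem_ker]
    refine (hD (planeGen i j)).unique ?_
    have : (fun t : ℝ => extChartAt (𝓡 n) x₀ (expG (t • planeGen i j) • x₀)) =
        fun _ => extChartAt (𝓡 n) x₀ x₀ := by
      funext t; rw [hx₀ _ (expG_rotation_mem_K hs t)]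
    rw [this]
    exact hasDerivAt_const _ _
  have hstep : ∀ a b c : Fin p ⊕ Fin q, sgn p q a = sgn p q b → a ≠ b → b ≠ c → a ≠ c →
      planeGen b c ∈ W → planeGen a c ∈ W := by
    intro a b c hs hab hbc hac hmem
    have hb : sgn p q b • planeGen a c ∈ W := by
      refine bracket_mem_of_Ad_mem W (planeGen a b) (planeGen b c) _
        (fun t => hAdW _ (expG_rotation_mem_K hs t) _ hmem) ?_
      rw [Submodule.coe_smul, planeGen_bracket hab hbc hac]
    have := W.smul_mem (sgn p q b) hb
    rwa [smul_smul, sgn_mul_self, one_smul] at this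
  have hsymm : ∀ a b : Fin p ⊕ Fin q, planeGen a b ∈ W → planeGen b a ∈ W := fun a b h => by
    rw [planeGen_swap]; exact W.neg_mem h
  -- the `pq` boosts have different characters under the half turns of `K`
  obtain ⟨i₀, j₀, h0⟩ : ∃ i j, planeGen (Sum.inl i : Fin p ⊕ Fin q) (Sum.inr j) ∈ W := by
    by_contra! hcon
    have hturn : ∀ k l : Fin p ⊕ Fin q, k ≠ l → sgn p q k = sgn p q l → ∀ a : Fin p × Fin q,
        T (halfTurn k l) (D (planeGen (Sum.inl a.1) (Sum.inr a.2))) =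
          (turnSign k l (Sum.inl a.1) * turnSign k l (Sum.inr a.2)) •
            D (planeGen (Sum.inl a.1) (Sum.inr a.2)) := by
      intro k l hkl hs a
      rw [hequiv (halfTurn k l) (expG_rotation_mem_K hs Real.pi), Ad_halfTurn hkl hs, map_smul]
    have hli := linearIndependent_of_separated
      (fun a : Fin p × Fin q => D (planeGen (Sum.inl a.1) (Sum.inr a.2)))
      (fun a => hcon a.1 a.2) (fun a b hab => by
        by_cases h1 : a.1 = b.1
        · have h2 : b.2 ≠ a.2 := fun h2 => hab (Prod.ext h1 h2.symm)
          obtain ⟨l, hl1, hl2, hl3⟩ := exists_third_index hp hq (Sum.inr a.2) (Sum.inr b.2)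
          rcases l with l | l
          · norm_num [sgn] at hl3
          refine ⟨(T (halfTurn (Sum.inr a.2) (Sum.inr l))).toLinearMap, _,
            hturn _ _ hl1 hl3, ?_⟩
          have h3 : b.2 ≠ l := by simpa using hl2
          simp [turnSign, h2, h3]
          norm_num
        · have h2 : b.1 ≠ a.1 := Ne.symm h1
          obtain ⟨l, hl1, hl2, hl3⟩ := exists_third_index hp hq (Sum.inl a.1) (Sum.inl b.1)
          rcases l with l | l
          · refine ⟨(T (halfTurn (Sum.inl a.1) (Sum.inl l))).toLinearMap, _,
              hturn _ _ hl1 hl3, ?_⟩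
            have h3 : b.1 ≠ l := by simpa using hl2
            simp [turnSign, h2, h3]
            norm_num
          · norm_num [sgn] at hl3)
    have hcard := hli.fintype_card_le_finrank
    rw [finrank_euclideanSpace_fin, Fintype.card_prod, Fintype.card_fin, Fintype.card_fin] at hcard
    omega
  have hboost : ∀ i j, planeGen (Sum.inl i : Fin p ⊕ Fin q) (Sum.inr j) ∈ W := by
    intro i j
    have h1 : planeGen (Sum.inl i : Fin p ⊕ Fin q) (Sum.inr j₀) ∈ W := by
      rcases eq_or_ne i i₀ with rfl | hi
      · exact h0
      · exact hstep _ (Sum.inl i₀) _ rfl (by simpa using hi) (by simp) (by simp) h0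
    rcases eq_or_ne j j₀ with rfl | hj
    · exact h1
    · exact hsymm _ _ (hstep _ (Sum.inr j₀) _ rfl (by simpa using hj) (by simp) (by simp)
        (hsymm _ _ h1))
  have hall : ∀ i j, planeGen i j ∈ W := by
    rintro (i | i) (j | j)
    · exact hrot _ _ rfl
    · exact hboost i j
    · exact hsymm _ _ (hboost j i)
    · exact hrot _ _ rfl
  have htop : MulAction.stabilizer (G p q) x₀ = ⊤ := by
    refine eq_top_of_planeGen _ fun i j _ t => ?_
    rw [MulAction.mem_stabilizer_iff]
    refine expG_smul_eq_of_deriv_eq_zero h ?_ t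
    have := hD (planeGen i j)
    rwa [LinearMap.mem_ker.1 (hall i j)] at this
  exact MulAction.mem_stabilizer_iff.1 (htop ▸ Subgroup.mem_top g)

end Action

end FixedPoints

end SOAction

end

theorem lemma4p2 (p q : ℕ) (hp : 3 ≤ p) (hq : 3 ≤ q)
    (M : Type*) [TopologicalSpace M] [T2Space M] [ConnectedSpace M]
    [ChartedSpace (EuclideanSpace ℝ (Fin (p + q - 1))) M]
    [IsManifold (𝓡 (p + q - 1)) ω M]
    [MulAction (SOAction.G p q) M]
    (hanalytic : SOAction.IsAnalyticAction p q (p + q - 1) M)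
    (hnontrivial : ∃ (g : SOAction.G p q) (x : M), g • x ≠ x) :
    MulAction.fixedPoints (SOAction.K p q) M = ∅ ∧
      MulAction.fixedPoints (SOAction.G p q) M = ∅ := by
  obtain ⟨g, x, hgx⟩ := hnontrivial
  have hK : MulAction.fixedPoints (SOAction.K p q) M = ∅ := by
    refine Set.eq_empty_iff_forall_notMem.2 fun x₀ hx₀ => hgx ?_
    have hdim : p + q - 1 < p * q := by
      have : p + q ≤ p * q := by nlinarith
      omega
    have hfix := SOAction.fixed_of_K_fixed hp hq hdim hanalytic (x₀ := x₀)
      fun k hk => hx₀ ⟨k, hk⟩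
    exact SOAction.smul_eq_self_of_fixed hp hq (by omega) hanalytic hfix g x
  refine ⟨hK, Set.eq_empty_iff_forall_notMem.2 fun x₀ hx₀ => ?_⟩
  exact Set.eq_empty_iff_forall_notMem.1 hK x₀ fun k => hx₀ k.1
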